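/- **Notation.** For a continuous $2\pi$-periodic $g:\mathbb R\to\mathbb C$ put $\hat g(k)=\frac1{2\pi}\int_{-\pi}^{\pi}g(\alpha)e^{-ik\alpha}\,d\alpha$. For $\nu\ge 0$ and $s>0$ let $$\|g\|_{\mathcal F^{0,1}_\nu}=\sum_{k\in\mathbb Z}e^{\nu|k|}|\hat g(k)|,\qquad \|g\|_{\dot{\mathcal F}^{s,1}_\nu}=\sum_{k\neq0}e^{\nu|k|}|k|^s|\hat g(k)|,$$ and let $\mathcal F^{0,1}_\nu$ be the set of continuous $2\pi$-periodic $g$ with $\|g\|_{\mathcal F^{0,1}_\nu}<\infty$. Principal values are $\mathrm{pv}\int_{-\pi}^{\pi}h(\beta)\,d\beta=\lim_{\varepsilon\to0^+}\int_{\varepsilon<|\beta|<\pi}h(\beta)\,d\beta$. For functions $\theta,f$, the nonlinear Birkhoff–Rott remainder operator is $$\begin{aligned}\mathcal S(f)(\alpha)=\;&\frac1\pi\sum_{\substack{n,l\ge0\\ n+l\ge2}}\frac{(-1)^n i^{\,l+n+1}\theta(\alpha)^l}{l!}\,\mathrm{pv}\!\int_{-\pi}^{\pi}\frac{f(\alpha-\beta)\,\beta^{n+1}}{\beta(1-e^{-i\beta})^{n+1}}\Big(\sum_{m\ge1}M_m(\alpha,\beta)\Big)^n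 d\beta\\&+\frac1\pi\,\mathrm{pv}\!\int_{-\pi}^{\pi}\frac{f(\alpha-\beta)\,\beta^{2}}{\beta(1-e^{-i\beta})^{2}}\sum_{m\ge2}M_m(\alpha,\beta)\,d\beta,\end{aligned}$$ $$M_m(\alpha,\beta)=\frac{i^m}{m!}\int_0^1e^{i(\tau-1)\beta}\,\theta(\alpha+(\tau-1)\beta)^m\,d\tau .$$ **Constants.** Let $\mathcal V=\frac14\int_{-\pi/2}^{\pi/2}\frac{\beta}{\sin\beta}\,d\beta$ (Catalan's constant), $\tilde{\mathcal C}=\frac4\pi\mathcal V\sqrt{1+\frac{\pi^2}{4}}$, $C_{\mathcal R}=1+\tilde{\mathcal C}$, $a_n=1+\tilde{\mathcal C}\,n(\frac\pi2)^{n-1}$ (so $a_0=1$), and $b(n,s)=1$ for $0\le s\le1$, $b(n,s)=n^{s-1}$ for $s>1$. For $x\ge0$ put $E_1=\frac{e^x-1}{x}$ and $E_2=\frac{e^x-1-x}{x^2}$ (with the limit values $1$ and $\frac12$ at $x=0$), and $$C_1(x)=\frac{\pi\tilde{\mathcal C}}2e^xE_1^2\,\frac{2-\frac\pi2(e^x-1)}{\big(1-\frac\pi2(e^x-1)\big)^2}+E_2+(1+\tilde{\mathcal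 C})E_1^2+\frac{e^xE_1^2}{2-e^x}+C_{\mathcal R}E_2,$$ $$C_3(s,x)=\sum_{\substack{n,l\ge0\\n+l\ge2}}\frac{b(l+n+1,s)}{l!}a_n x^{n+l-2}E_1^n+C_{\mathcal R}\sum_{m\ge0}\frac{b(m+3,s)}{(m+2)!}x^m,$$ $$C_4(s,x)=\sum_{\substack{n,l\ge0\\n+l\ge2}}\frac{b(l+n+1,s)}{l!}a_n x^{n+l-2}\Big(l\,E_1^n+n\,E_1^{n-1}\sum_{m\ge1}\frac{b(m,s)}{(m-1)!}x^{m-1}\Big)+C_{\mathcal R}\sum_{m\ge0}\frac{b(m+3,s)}{(m+1)!}x^m .$$ **Proposition 5.4.** Let $\nu\ge0$, let $f,\theta\in\mathcal F^{0,1}_\nu$, write $x=\|\theta\|_{\mathcal F^{0,1}_\nu}$, and suppose $\frac\pi2(e^{x}-1)<1$. Then all series and principal values in the definition of $\mathcal S(f)(\alpha)$ converge for every $\alpha$ (the series over $(n,l)$ absolutely), $\mathcal S(f)\in\mathcal F^{0,1}_\nu$, $C_1(x)>0$, and $$\|\mathcal S(f)\|_{\mathcal F^{0,1}_\nu}\le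 C_1(x)\,\|\theta\|_{\mathcal F^{0,1}_\nu}^2\,\|f\|_{\mathcal F^{0,1}_\nu}.$$ Moreover, for every $s>0$ the series defining $C_3(s,x)$ and $C_4(s,x)$ converge, $C_3(s,x)$ and $C_4(s,x)$ are positive, and if $\|f\|_{\dot{\mathcal F}^{s,1}_\nu}$ and $\|\theta\|_{\dot{\mathcal F}^{s,1}_\nu}$ are finite, then $\|\mathcal S(f)\|_{\dot{\mathcal F}^{s,1}_\nu}$ is finite and $$\|\mathcal S(f)\|_{\dot{\mathcal F}^{s,1}_\nu}\le C_3(s,x)\,\|\theta\|_{\mathcal F^{0,1}_\nu}^2\,\|f\|_{\dot{\mathcal F}^{s,1}_\nu}+C_4(s,x)\,\|\theta\|_{\mathcal F^{0,1}_\nu}\,\|f\|_{\mathcal F^{0,1}_\nu}\,\|\theta\|_{\dot{\mathcal F}^{s,1}_\nu}.$$ -/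

import Mathlib

open scoped Real Topology

namespace BirkhoffRott

noncomputable section

/-! ### Fourier coefficients and the weighted Wiener norms -/

/-- The Fourier coefficient `(1 / 2π) ∫_{-π}^{π} g(α) e^{-ikα} dα` of a `2π`-periodic function. -/
def fhat (g : ℝ → ℂ) (k : ℤ) : ℂ :=
  fourierCoeffOn (neg_lt_self Real.pi_pos) g k

/-- The `k`-th term of the series that defines the norm of `𝓕^{0,1}_ν`. -/
def normTerm (ν : ℝ) (g : ℝ → ℂ) (k : ℤ) : ℝ :=
  Real.exp (ν * |(k : ℝ)|) * ‖fhat g k‖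

/-- The norm `∑_{k ∈ ℤ} e^{ν|k|} |ĝ(k)|` of `𝓕^{0,1}_ν`. -/
def normF (ν : ℝ) (g : ℝ → ℂ) : ℝ :=
  ∑' k : ℤ, normTerm ν g k

/-- Membership in `𝓕^{0,1}_ν`: a continuous `2π`-periodic function
with `∑_{k ∈ ℤ} e^{ν|k|} |ĝ(k)| < ∞`. -/
structure MemF (ν : ℝ) (g : ℝ → ℂ) : Prop where
  continuous : Continuous g
  periodic : Function.Periodic g (2 * π)
  summable : Summable (normTerm ν g)

/-- The `k`-th term, `k ≠ 0`, of the series that defines the norm of the homogeneous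
space with exponent `s`. -/
def homNormTerm (ν s : ℝ) (g : ℝ → ℂ) (k : {k : ℤ // k ≠ 0}) : ℝ :=
  Real.exp (ν * |((k : ℤ) : ℝ)|) * |((k : ℤ) : ℝ)| ^ s * ‖fhat g k‖

/-- The homogeneous norm `∑_{k ≠ 0} e^{ν|k|} |k|^s |ĝ(k)|`. -/
def homNormF (ν s : ℝ) (g : ℝ → ℂ) : ℝ :=
  ∑' k : {k : ℤ // k ≠ 0}, homNormTerm ν s g k

/-- The homogeneous norm with exponent `s` is finite. -/
def FiniteHomNormF (ν s : ℝ) (g : ℝ → ℂ) : Prop :=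
  Summable (homNormTerm ν s g)

/-! ### Principal values -/

/-- The integral of `g` over `ε < |β| < π`. -/
def truncIntegral (g : ℝ → ℂ) (ε : ℝ) : ℂ :=
  (∫ β in (-π)..(-ε), g β) + ∫ β in ε..π, g β

/-- The principal value integral of `g` over `[-π, π]`, with the singularity at `0`, exists. -/
def PVExists (g : ℝ → ℂ) : Prop :=
  (∀ ε : ℝ, 0 < ε → ε < π →
    IntervalIntegrable g MeasureTheory.volume (-π) (-ε) ∧
    IntervalIntegrable g MeasureTheory.volume ε π) ∧
  ∃ L : ℂ, Filter.Tendsto (truncIntegral g) (𝓝[>] 0) (𝓝 L)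

/-- The principal value `lim_{ε → 0+} ∫_{ε < |β| < π} g(β) dβ`. -/
def pv (g : ℝ → ℂ) : ℂ :=
  Filter.limUnder (𝓝[>] (0 : ℝ)) (truncIntegral g)

/-! ### The operator `S` -/

/-- `(i^m / m!) ∫_0^1 e^{i(τ-1)β} θ(α + (τ-1)β)^m dτ`. -/
def taylorTerm (θ : ℝ → ℂ) (α β : ℝ) (m : ℕ) : ℂ :=
  Complex.I ^ m / (Nat.factorial m : ℂ) *
    ∫ τ in (0 : ℝ)..1,
      Complex.exp (Complex.I * (((τ - 1) * β : ℝ) : ℂ)) * θ (α + (τ - 1) * β) ^ m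

/-- The sum of the Taylor terms over `m ≥ 1`. -/
def taylorSum₁ (θ : ℝ → ℂ) (α β : ℝ) : ℂ :=
  ∑' m : ℕ, taylorTerm θ α β (m + 1)

/-- The sum of the Taylor terms over `m ≥ 2`. -/
def taylorSum₂ (θ : ℝ → ℂ) (α β : ℝ) : ℂ :=
  ∑' m : ℕ, taylorTerm θ α β (m + 2)

/-- The integrand `f(α-β) β^{n+1} / (β (1 - e^{-iβ})^{n+1}) (∑_{m ≥ 1} ⋯)^n`. -/
def kernelN (f θ : ℝ → ℂ) (n : ℕ) (α β : ℝ) : ℂ :=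
  f (α - β) * (β : ℂ) ^ (n + 1) /
      ((β : ℂ) * (1 - Complex.exp (-(Complex.I * (β : ℂ)))) ^ (n + 1)) *
    taylorSum₁ θ α β ^ n

/-- The integrand `f(α-β) β^2 / (β (1 - e^{-iβ})^2) ∑_{m ≥ 2} ⋯`. -/
def kernelTail (f θ : ℝ → ℂ) (α β : ℝ) : ℂ :=
  f (α - β) * (β : ℂ) ^ 2 /
      ((β : ℂ) * (1 - Complex.exp (-(Complex.I * (β : ℂ)))) ^ 2) *
    taylorSum₂ θ α β

/-- The pairs `(n, l)` of natural numbers with `n + l ≥ 2`. -/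
abbrev Idx : Type := {p : ℕ × ℕ // 2 ≤ p.1 + p.2}

/-- The term of index `(n, l)` of the series in the definition of `S`. -/
def sTerm (θ f : ℝ → ℂ) (α : ℝ) (p : Idx) : ℂ :=
  (-1) ^ p.1.1 * Complex.I ^ (p.1.2 + p.1.1 + 1) * θ α ^ p.1.2 /
      (Nat.factorial p.1.2 : ℂ) *
    pv (kernelN f θ p.1.1 α)

/-- The nonlinear remainder operator `S(f)`, which depends on `θ`. -/
def S (θ f : ℝ → ℂ) (α : ℝ) : ℂ :=
  1 / (π : ℂ) * (∑' p : Idx, sTerm θ f α p) + 1 / (π : ℂ) * pv (kernelTail f θ α)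

/-- All series and principal values in the definition of `S(f)` converge at every point. -/
structure SConverges (θ f : ℝ → ℂ) : Prop where
  taylor : ∀ α β : ℝ, Summable (taylorTerm θ α β)
  pv_kernelN : ∀ (α : ℝ) (n : ℕ), PVExists (kernelN f θ n α)
  pv_kernelTail : ∀ α : ℝ, PVExists (kernelTail f θ α)
  series : ∀ α : ℝ, Summable (sTerm θ f α)

/-! ### The constants -/

/-- Catalan's constant `(1/4) ∫_{-π/2}^{π/2} β / sin β dβ`. -/
def catalanConst : ℝ :=
  1 / 4 * ∫ β in (-(π / 2))..(π / 2), β / Real.sin β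

/-- `C̃ = (4/π) 𝒱 √(1 + π²/4)`. -/
def Ctilde : ℝ :=
  4 / π * catalanConst * Real.sqrt (1 + π ^ 2 / 4)

/-- `C_R = 1 + C̃`. -/
def CR : ℝ := 1 + Ctilde

/-- `a_n = 1 + C̃ n (π/2)^{n-1}`, so that `a_0 = 1`. -/
def aCoef (n : ℕ) : ℝ :=
  1 + Ctilde * n * (π / 2) ^ (n - 1)

/-- `b(n, s) = 1` for `s ≤ 1` and `b(n, s) = n^{s-1}` for `s > 1`. -/
def bCoef (n : ℕ) (s : ℝ) : ℝ :=
  if s ≤ 1 then 1 else (n : ℝ) ^ (s - 1)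

/-- `(e^x - 1) / x`, with its limit value `1` at `x = 0`. -/
def expQuot₁ (x : ℝ) : ℝ :=
  if x = 0 then 1 else (Real.exp x - 1) / x

/-- `(e^x - 1 - x) / x^2`, with its limit value `1/2` at `x = 0`. -/
def expQuot₂ (x : ℝ) : ℝ :=
  if x = 0 then 1 / 2 else (Real.exp x - 1 - x) / x ^ 2

/-- The constant `C̃_1(x)`; note `(e^x - 1)^2 / x^2 = expQuot₁ x ^ 2` for `x ≠ 0`. -/
def C1tilde (x : ℝ) : ℝ :=
  π * Ctilde / 2 * (Real.exp x * expQuot₁ x ^ 2) *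
      ((2 - π / 2 * (Real.exp x - 1)) / (1 - π / 2 * (Real.exp x - 1)) ^ 2)
    + expQuot₂ x
    + (1 + Ctilde) * expQuot₁ x ^ 2
    + Real.exp x * expQuot₁ x ^ 2 / (2 - Real.exp x)

/-- `C_1 = C̃_1 + C_R (e^x - 1 - x) / x^2`. -/
def C1 (x : ℝ) : ℝ := C1tilde x + CR * expQuot₂ x

/-- The term of index `(n, l)` of the series `C̃_3`. -/
def C3tildeTerm (s x : ℝ) (p : Idx) : ℝ :=
  bCoef (p.1.2 + p.1.1 + 1) s / (Nat.factorial p.1.2 : ℝ) * aCoef p.1.1 *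
    x ^ (p.1.1 + p.1.2 - 2) * expQuot₁ x ^ p.1.1

/-- The term `b(m, s) x^{m-1} / (m-1)!` with `m` replaced by `m + 1`, `m ≥ 0`. -/
def C5Term (s x : ℝ) (m : ℕ) : ℝ :=
  bCoef (m + 1) s / (Nat.factorial m : ℝ) * x ^ m

/-- `C̃_5 = n ((e^x - 1)/x)^{n-1} ∑_{m ≥ 1} b(m, s) x^{m-1} / (m-1)!`. -/
def C5tilde (s x : ℝ) (n : ℕ) : ℝ :=
  n * expQuot₁ x ^ (n - 1) * ∑' m : ℕ, C5Term s x m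

/-- The term of index `(n, l)` of the series `C̃_4`. -/
def C4tildeTerm (s x : ℝ) (p : Idx) : ℝ :=
  bCoef (p.1.2 + p.1.1 + 1) s / (Nat.factorial p.1.2 : ℝ) * aCoef p.1.1 *
    x ^ (p.1.1 + p.1.2 - 2) * (p.1.2 * expQuot₁ x ^ p.1.1 + C5tilde s x p.1.1)

/-- The term of index `m ≥ 0` of the series `C̆_3`. -/
def C3breveTerm (s x : ℝ) (m : ℕ) : ℝ :=
  bCoef (m + 3) s / (Nat.factorial (m + 2) : ℝ) * x ^ m

/-- The term of index `m ≥ 0` of the series `C̆_4`. -/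
def C4breveTerm (s x : ℝ) (m : ℕ) : ℝ :=
  bCoef (m + 3) s / (Nat.factorial (m + 1) : ℝ) * x ^ m

/-- `C_3 = C̃_3 + C_R C̆_3`. -/
def C3 (s x : ℝ) : ℝ :=
  (∑' p : Idx, C3tildeTerm s x p) + CR * ∑' m : ℕ, C3breveTerm s x m

/-- `C_4 = C̃_4 + C_R C̆_4`. -/
def C4 (s x : ℝ) : ℝ :=
  (∑' p : Idx, C4tildeTerm s x p) + CR * ∑' m : ℕ, C4breveTerm s x m

/-- All the series that define `C_3` and `C_4` converge. -/
structure ConstSeriesConverge (s x : ℝ) : Prop where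
  c3tilde : Summable (C3tildeTerm s x)
  c4tilde : Summable (C4tildeTerm s x)
  c5 : Summable (C5Term s x)
  c3breve : Summable (C3breveTerm s x)
  c4breve : Summable (C4breveTerm s x)

end

end BirkhoffRott

/-! Expand `f` and `θ` in Fourier series and follow single modes through the operator. With `quot β
= β/(1 - e^{-iβ})` and `den β = 1 - e^{-iβ}`, the kernel of index `n` is `f(α-β)` times the `n`-th
power of `quot β · ∑ M_m`, divided by one spare `den β`. A mode `e^{iKx}` of `θ^m`, averaged over
`τ`, gives `(1 - e^{-ipβ})/(ipβ)` with `p = K + 1`. Multiplying by `quot β` cancels `β`, and `1 -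
e^{-ipβ}` is `den β` times a geometric sum, so for `p > 0` what remains is `-i` times a mean of
exponentials. The case `p < 0` is the same up to a factor `e^{-ipβ}`, and `p = 0` leaves `quot β`
itself (`exists_mode_avg`). Hence every mode of the kernel has the form `e^{iKα} u(β)/den β` with
`u` in the absolutely convex hull `Mode n` of the functions `e^{-iQβ} quot^r`, `r ≤ n`.

For such `u` the principal value is at most `π a_n` (`Mode.tsum` plays no role here; the bound is
`Mode.tendsto_modeInt`). Indeed `quot → -i` at the origin, so `quot^r` may be replaced by `(-i)^r`,
which leaves the principal value of `e^{-iQβ}/den`, equal to `±π`. The error is integrable and costs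
`π C̃ r (π/2)^{r-1}`, by the pointwise bound `norm_quot_add_I_div_le`. Exchanging the limit `ε → 0`
with the sum over modes needs a bound uniform in `Q` and `ε`. It comes from the bounded partial sums
of `∑ sin(jε)/j` (`sin_series_bound`).

The bookkeeping is carried by `Rep`, an absolutely convergent expansion that records two numbers in
`[0, ∞]`: `X` controls the `𝓕^{0,1}_ν` norm, and `Y` also weights each mode by the sum of `ω` over
its constituent frequencies. Under products `X` is multiplicative and `Y` obeys the Leibniz rule
(`Rep.mul`). The inequality `|k_1 + ⋯ + k_N|^s ≤ b(N,s) ∑ |k_j|^s` converts `Y` into a homogeneous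
norm (`Rep.collapse`). Summing over `(n, l)` gives `C_3` and `C_4` term by term, and for `X` a
double series whose closed form is `C_1` (`hasSum_C1Term`). Smallness of `(π/2)(e^x - 1)` is what
makes these series converge. -/

namespace BirkhoffRott

noncomputable section

open MeasureTheory Filter
open scoped ENNReal

/-! ### The denominator `1 - e^{-iβ}` -/

/-- The punctured interval `0 < |β| ≤ π`. -/
def punct : Set ℝ := {β | β ≠ 0 ∧ |β| ≤ π}

/-- `1 - e^{-iβ}`. -/
def den (β : ℝ) : ℂ := 1 - Complex.exp (-(Complex.I * (β : ℂ)))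

/-- `β / (1 - e^{-iβ})`. -/
def quot (β : ℝ) : ℂ := (β : ℂ) / den β

/-- The exponential `e^{-iQβ}`. -/
def wave (Q : ℤ) (β : ℝ) : ℂ := Complex.exp (-(Complex.I * (Q * β : ℂ)))

lemma norm_wave (Q : ℤ) (β : ℝ) : ‖wave Q β‖ = 1 := by
  have : wave Q β = Complex.exp (((-(Q * β) : ℝ) : ℂ) * Complex.I) := by
    unfold wave; congr 1; push_cast; ring
  rw [this, Complex.norm_exp_ofReal_mul_I]

lemma wave_zero : wave 0 = fun _ => 1 := by
  funext β; simp [wave]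

lemma wave_add (P Q : ℤ) (β : ℝ) : wave (P + Q) β = wave P β * wave Q β := by
  unfold wave; rw [← Complex.exp_add]; congr 1; push_cast; ring

lemma measurable_wave (Q : ℤ) : Measurable (wave Q) := by
  unfold wave; fun_prop

lemma measurable_den : Measurable den := by
  unfold den; fun_prop

lemma measurable_quot : Measurable quot := by
  unfold quot; exact Complex.measurable_ofReal.div measurable_den

lemma den_eq (β : ℝ) : den β = 1 - wave 1 β := by simp [den, wave]

lemma norm_den (β : ℝ) : ‖den β‖ = 2 * |Real.sin (β / 2)| := by
  have h := Complex.norm_exp_I_mul_ofReal_sub_one (-β)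
  rw [norm_sub_rev] at h
  have e : den β = 1 - Complex.exp (Complex.I * ((-β : ℝ) : ℂ)) := by
    unfold den; congr 2; push_cast; ring
  rw [e, h, neg_div, Real.sin_neg, norm_mul]
  simp

lemma abs_le_norm_den {β : ℝ} (h : |β| ≤ π) : 2 / π * |β| ≤ ‖den β‖ := by
  have h1 : |Real.sin (β / 2)| = Real.sin (|β| / 2) := by
    rcases abs_cases β with ⟨e, h0⟩ | ⟨e, h0⟩
    · rw [e] at h ⊢
      exact abs_of_nonneg (Real.sin_nonneg_of_nonneg_of_le_pi (by linarith) (by linarith [Real.pi_pos]))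
    · rw [e] at h ⊢
      rw [neg_div, Real.sin_neg]
      exact abs_of_nonpos (Real.sin_nonpos_of_nonpos_of_neg_pi_le (by linarith) (by linarith [Real.pi_pos]))
  have h2 := Real.mul_le_sin (x := |β| / 2) (by positivity) (by linarith)
  rw [norm_den, h1]
  linarith

lemma den_ne_zero {β : ℝ} (h : β ∈ punct) : den β ≠ 0 := by
  have h1 := abs_le_norm_den h.2
  have h2 : 0 < |β| := abs_pos.2 h.1
  have : 0 < ‖den β‖ := lt_of_lt_of_le (by positivity) h1
  exact norm_pos_iff.1 this

lemma norm_quot_le {β : ℝ} (h : β ∈ punct) : ‖quot β‖ ≤ π / 2 := by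
  have h1 := abs_le_norm_den h.2
  have h3 : 0 < ‖den β‖ := norm_pos_iff.2 (den_ne_zero h)
  unfold quot
  rw [norm_div, Complex.norm_real, Real.norm_eq_abs, div_le_iff₀ h3]
  have := mul_le_mul_of_nonneg_left h1 (by positivity : 0 ≤ π / 2)
  have e : π / 2 * (2 / π * |β|) = |β| := by field_simp
  linarith

/-- The left side is nonnegative because `t ≤ tan t`. Since `sin t ≤ t` and `1 - cos t ≤ sin t`, it
is at most `t sin t`; the factor `π/2` is slack that matches the constant `√(1 + π²/4)`. -/
lemma sin_sub_mul_cos_abs_le {t : ℝ} (h0 : 0 ≤ t) (h1 : t ≤ π / 2) :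
    |Real.sin t - t * Real.cos t| ≤ π / 2 * (t * Real.sin t) := by
  have hs : 0 ≤ Real.sin t := Real.sin_nonneg_of_nonneg_of_le_pi h0 (by linarith [Real.pi_pos])
  have hc : 0 ≤ Real.cos t := Real.cos_nonneg_of_neg_pi_div_two_le_of_le (by linarith) h1
  have hst : Real.sin t ≤ t := Real.sin_le h0
  have hcs : 1 - Real.cos t ≤ Real.sin t := by
    nlinarith [Real.sin_sq_add_cos_sq t, mul_nonneg hs hc]
  have hpos : 0 ≤ Real.sin t - t * Real.cos t := by
    rcases h1.eq_or_lt with h | h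
    · subst h; simp
    · have := Real.le_tan h0 h
      have hc' : 0 < Real.cos t := Real.cos_pos_of_mem_Ioo ⟨by linarith [Real.pi_pos], h⟩
      rw [Real.tan_eq_sin_div_cos, le_div_iff₀ hc'] at this
      linarith
  rw [abs_of_nonneg hpos]
  have h3 : Real.sin t - t * Real.cos t ≤ t * Real.sin t := by
    nlinarith [mul_le_mul_of_nonneg_left hcs h0]
  have h4 : 0 ≤ t * Real.sin t := by positivity
  nlinarith [Real.pi_gt_three]

/-- The majorant of `|β / (1 - e^{-iβ}) + i| / |1 - e^{-iβ}|` behind the constant `C̃`. -/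
def quotMajorant (β : ℝ) : ℝ :=
  1 / 2 * ((β / 2) / Real.sin (β / 2)) * Real.sqrt (1 + π ^ 2 / 4)

lemma div_sin_abs (t : ℝ) : t / Real.sin t = |t| / Real.sin |t| := by
  rcases abs_cases t with ⟨e, _⟩ | ⟨e, _⟩
  · rw [e]
  · rw [e, Real.sin_neg, neg_div_neg_eq]

/-- With `t = β/2`, the product `(quot β + i) den β` has modulus `2 |(t cos t - sin t) + i t sin
t|`. The previous estimate bounds this by `2 |t| sin|t| √(1 + π²/4)`, and `|den β| = 2 sin|t|` is
divided out twice. -/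
lemma norm_quot_add_I_div_le {β : ℝ} (h : β ∈ punct) :
    ‖quot β + Complex.I‖ / ‖den β‖ ≤ quotMajorant β := by
  set t := β / 2 with ht
  have ha : |t| ≤ π / 2 := by
    rw [ht, abs_div, abs_two]; linarith [h.2]
  have ha0 : 0 < |t| := abs_pos.2 (by have := h.1; simpa [ht] using this)
  have hsin : 0 < Real.sin |t| := Real.sin_pos_of_pos_of_lt_pi ha0 (by linarith [Real.pi_pos])
  have hsabs : |Real.sin t| = Real.sin |t| := by
    rcases abs_cases t with ⟨e, _⟩ | ⟨e, _⟩
    · rw [e] at hsin ⊢; exact abs_of_pos hsin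
    · rw [e] at hsin ⊢; rw [Real.sin_neg] at hsin ⊢; exact abs_of_neg (by linarith)
  have hd := den_ne_zero h
  have key : (quot β + Complex.I) * den β
      = 2 * Complex.exp (-(Complex.I * t)) *
        (((t * Real.cos t - Real.sin t : ℝ) : ℂ) + ((t * Real.sin t : ℝ) : ℂ) * Complex.I) := by
    have hb : (β : ℂ) = 2 * (t : ℂ) := by rw [ht]; push_cast; ring
    have e1 : Complex.exp (-(Complex.I * t)) = Real.cos t - Real.sin t * Complex.I := by
      rw [show -(Complex.I * (t : ℂ)) = ((-t : ℝ) : ℂ) * Complex.I by push_cast; ring,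
        Complex.exp_mul_I, ← Complex.ofReal_cos, ← Complex.ofReal_sin, Real.cos_neg, Real.sin_neg]
      push_cast; ring
    have e2 : Complex.exp (-(Complex.I * β)) = (Real.cos t - Real.sin t * Complex.I) ^ 2 := by
      rw [← e1, ← Complex.exp_nat_mul, hb]; congr 1; push_cast; ring
    have hcs : (Real.cos t : ℂ) ^ 2 = 1 - (Real.sin t : ℂ) ^ 2 := by
      have := Real.sin_sq_add_cos_sq t
      have h' : ((Real.sin t ^ 2 + Real.cos t ^ 2 : ℝ) : ℂ) = 1 := by rw [this]; simp
      push_cast at h' ⊢; linear_combination h'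
    have hI := Complex.I_sq
    have : (quot β + Complex.I) * den β = β + Complex.I * den β := by
      unfold quot; field_simp
    rw [this, den, e1, e2, hb]
    push_cast at hcs ⊢
    -- What is left is polynomial in `c`, `s`, `i`, `t` and follows from `c² = 1 - s²` and `i² =
    -- -1`.
    generalize Complex.cos (t : ℂ) = c at *
    generalize Complex.sin (t : ℂ) = s at *
    generalize Complex.I = i at *
    linear_combination (-i - 2 * (t : ℂ)) * hcs + (2 * c * s - i * s ^ 2 + 2 * (t : ℂ) * s ^ 2) * hI
  have hn : ‖quot β + Complex.I‖ * ‖den β‖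
      ≤ 2 * (|t| * Real.sin |t| * Real.sqrt (1 + π ^ 2 / 4)) := by
    rw [← norm_mul, key, norm_mul, norm_mul, Complex.norm_add_mul_I]
    have : ‖Complex.exp (-(Complex.I * t))‖ = 1 := by
      rw [show -(Complex.I * (t : ℂ)) = ((-t : ℝ) : ℂ) * Complex.I by push_cast; ring,
        Complex.norm_exp_ofReal_mul_I]
    rw [this, mul_one, Complex.norm_ofNat]
    refine mul_le_mul_of_nonneg_left ?_ (by norm_num)
    have hts : 0 ≤ |t| * Real.sin |t| := by positivity
    rw [← Real.sqrt_sq hts, ← Real.sqrt_mul (sq_nonneg _)]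
    apply Real.sqrt_le_sqrt
    have h2 := sin_sub_mul_cos_abs_le ha0.le ha
    have h3 := sq_le_sq' (by linarith [neg_abs_le (Real.sin |t| - |t| * Real.cos |t|)])
      ((le_abs_self _).trans h2)
    have h4 : (t * Real.cos t - Real.sin t) ^ 2 = (Real.sin |t| - |t| * Real.cos |t|) ^ 2 := by
      rcases abs_cases t with ⟨e, _⟩ | ⟨e, _⟩
      · rw [e]; ring
      · rw [e, Real.sin_neg, Real.cos_neg]; ring
    have h5 : (t * Real.sin t) ^ 2 = (|t| * Real.sin |t|) ^ 2 := by
      rw [mul_pow, mul_pow, ← hsabs, sq_abs, sq_abs]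
    rw [h4, h5]
    nlinarith [h3]
  have hdn : 0 < ‖den β‖ := norm_pos_iff.2 hd
  have hdv : ‖den β‖ = 2 * Real.sin |t| := by rw [norm_den, ← ht, hsabs]
  unfold quotMajorant
  rw [← ht, div_sin_abs, div_le_iff₀ hdn]
  rw [hdv] at hn ⊢
  have : 1 / 2 * (|t| / Real.sin |t|) * Real.sqrt (1 + π ^ 2 / 4) * (2 * Real.sin |t|)
      = |t| * Real.sqrt (1 + π ^ 2 / 4) := by field_simp
  rw [this]
  have h6 : ‖quot β + Complex.I‖ * (2 * Real.sin |t|)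
    ≤ |t| * Real.sqrt (1 + π ^ 2 / 4) * (2 * Real.sin |t|) := by linarith
  exact le_of_mul_le_mul_right h6 (by positivity)

lemma quotMajorant_nonneg {β : ℝ} (h : |β| ≤ π) : 0 ≤ quotMajorant β := by
  unfold quotMajorant
  rw [div_sin_abs]
  have : 0 ≤ Real.sin |β / 2| := Real.sin_nonneg_of_nonneg_of_le_pi (abs_nonneg _)
    (by rw [abs_div, abs_two]; linarith [Real.pi_pos])
  positivity

lemma quotMajorant_le {β : ℝ} (h : |β| ≤ π) :
    quotMajorant β ≤ π / 4 * Real.sqrt (1 + π ^ 2 / 4) := by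
  unfold quotMajorant
  refine mul_le_mul_of_nonneg_right ?_ (Real.sqrt_nonneg _)
  rw [div_sin_abs]
  have ha : |β / 2| ≤ π / 2 := by rw [abs_div, abs_two]; linarith
  have hs := Real.mul_le_sin (abs_nonneg (β / 2)) ha
  have : |β / 2| / Real.sin |β / 2| ≤ π / 2 := by
    rcases (abs_nonneg (β / 2)).eq_or_lt with h0 | h0
    · rw [← h0]; simp; positivity
    · rw [div_le_iff₀ (lt_of_lt_of_le (by positivity) hs)]
      have := mul_le_mul_of_nonneg_left hs (by positivity : 0 ≤ π / 2)
      have e : π / 2 * (2 / π * |β / 2|) = |β / 2| := by field_simp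
      linarith
  linarith

lemma measurable_quotMajorant : Measurable quotMajorant := by
  unfold quotMajorant; fun_prop

lemma integrableOn_quotMajorant : IntegrableOn quotMajorant (Set.Ioc (-π) π) := by
  refine Measure.integrableOn_of_bounded (M := π / 4 * Real.sqrt (1 + π ^ 2 / 4)) (by simp)
    measurable_quotMajorant.aestronglyMeasurable ?_
  refine (ae_restrict_iff' measurableSet_Ioc).2 (ae_of_all _ fun β hβ => ?_)
  have : |β| ≤ π := abs_le.2 ⟨hβ.1.le, hβ.2⟩
  rw [Real.norm_eq_abs, abs_of_nonneg (quotMajorant_nonneg this)]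
  exact quotMajorant_le this

/-- The substitution `t = β/2` turns the integral into the one defining Catalan's constant; this is
the origin of `C̃`. -/
lemma integral_quotMajorant : ∫ β in (-π)..π, quotMajorant β = π * Ctilde := by
  unfold quotMajorant
  rw [intervalIntegral.integral_mul_const, intervalIntegral.integral_const_mul,
    intervalIntegral.integral_comp_div (fun t => t / Real.sin t) (two_ne_zero), Ctilde,
    catalanConst, neg_div]
  simp only [smul_eq_mul]
  field_simp

lemma Ctilde_nonneg : 0 ≤ Ctilde := by
  unfold Ctilde catalanConst
  have : 0 ≤ ∫ β in (-(π / 2))..(π / 2), β / Real.sin β := by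
    refine intervalIntegral.integral_nonneg (by linarith [Real.pi_pos]) fun t ht => ?_
    rw [div_sin_abs]
    exact div_nonneg (abs_nonneg _) (Real.sin_nonneg_of_nonneg_of_le_pi (abs_nonneg _)
      ((abs_le.2 ht).trans (by linarith [Real.pi_pos])))
  positivity

lemma aCoef_pos (n : ℕ) : 0 < aCoef n := by
  unfold aCoef
  have := Ctilde_nonneg
  positivity

lemma aCoef_mono : Monotone aCoef := by
  intro m n h
  unfold aCoef
  have h1 := Ctilde_nonneg
  have h2 : (1 : ℝ) ≤ π / 2 := by linarith [Real.pi_gt_three]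
  have h3 : (m : ℝ) ≤ n := by exact_mod_cast h
  have h4 : (π / 2) ^ (m - 1) ≤ (π / 2) ^ (n - 1) := pow_le_pow_right₀ h2 (by omega)
  gcongr

/-! ### Bounded partial sums of the sawtooth series -/

/-- Summation by parts: `sin(Nx)` is a difference of consecutive half-integer cosines over `2
sin(x/2)`. The boundary term is kept on the left and `-1/(M+k+1)` on the right so that the induction
telescopes. -/
lemma sin_series_tail_bound {x : ℝ} (h0 : 0 < x) (h1 : x ≤ π) (M k : ℕ) :
    |∑ j ∈ Finset.range k, Real.sin (((M + j + 1 : ℕ) : ℝ) * x) / ((M + j + 1 : ℕ) : ℝ)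
        + Real.cos (((M + k : ℕ) + 1 / 2 : ℝ) * x) / (2 * Real.sin (x / 2)) / ((M + k + 1 : ℕ) : ℝ)|
      ≤ 1 / (2 * Real.sin (x / 2)) * (2 / ((M + 1 : ℕ) : ℝ) - 1 / ((M + k + 1 : ℕ) : ℝ)) := by
  have hs : 0 < Real.sin (x / 2) :=
    Real.sin_pos_of_pos_of_lt_pi (by linarith) (by linarith [Real.pi_pos])
  induction k with
  | zero =>
    simp only [Finset.range_zero, Finset.sum_empty, zero_add, add_zero]
    rw [abs_div, abs_div, abs_of_pos (by positivity : 0 < 2 * Real.sin (x / 2)), Nat.abs_cast]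
    have : |Real.cos (((M : ℕ) + 1 / 2 : ℝ) * x)| ≤ 1 := Real.abs_cos_le_one _
    have h2 : (2 : ℝ) / ((M + 1 : ℕ) : ℝ) - 1 / ((M + 1 : ℕ) : ℝ) = 1 / ((M + 1 : ℕ) : ℝ) := by ring
    rw [h2, div_div, one_div_mul_one_div]
    gcongr
  | succ k ih =>
    rw [Finset.sum_range_succ]
    set B := 1 / (2 * Real.sin (x / 2)) with hB
    have hBp : 0 < B := by positivity
    set S := ∑ j ∈ Finset.range k, Real.sin (((M + j + 1 : ℕ) : ℝ) * x) / ((M + j + 1 : ℕ) : ℝ)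
    set N : ℝ := ((M + k + 1 : ℕ) : ℝ) with hN
    have hNp : 0 < N := by rw [hN]; positivity
    have hsin : Real.sin (N * x) = (Real.cos (((M + k : ℕ) + 1 / 2 : ℝ) * x)
        - Real.cos (((M + (k + 1) : ℕ) + 1 / 2 : ℝ) * x)) * B := by
      have e1 : (((M + k : ℕ) + 1 / 2 : ℝ) * x) = N * x - x / 2 := by rw [hN]; push_cast; ring
      have e2 : (((M + (k + 1) : ℕ) + 1 / 2 : ℝ) * x) = N * x + x / 2 := by
        rw [hN]; push_cast; ring
      rw [e1, e2, Real.cos_sub, Real.cos_add, hB]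
      field_simp
      ring
    have e3 : ((M + (k + 1) + 1 : ℕ) : ℝ) = N + 1 := by rw [hN]; push_cast; ring
    rw [hsin, e3]
    set A := Real.cos (((M + k : ℕ) + 1 / 2 : ℝ) * x) with hA
    set A' := Real.cos (((M + (k + 1) : ℕ) + 1 / 2 : ℝ) * x) with hA'
    have hA1 : |A'| ≤ 1 := Real.abs_cos_le_one _
    have e4 : S + (A - A') * B / N + A' / (2 * Real.sin (x / 2)) / (N + 1)
        = (S + A / (2 * Real.sin (x / 2)) / N) - A' * (B * (1 / N - 1 / (N + 1))) := by
      rw [hB]; ring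
    rw [e4]
    have h5 : 0 ≤ 1 / N - 1 / (N + 1) :=
      sub_nonneg.2 (one_div_le_one_div_of_le hNp (by linarith))
    calc _ ≤ _ := abs_sub _ _
      _ ≤ B * (2 / ((M + 1 : ℕ) : ℝ) - 1 / N) + 1 * (B * (1 / N - 1 / (N + 1))) := by
        refine add_le_add ih ?_
        rw [abs_mul, abs_of_nonneg (mul_nonneg hBp.le h5)]
        exact mul_le_mul_of_nonneg_right hA1 (mul_nonneg hBp.le h5)
      _ = _ := by ring

lemma sin_series_tail_bound' {x : ℝ} (h0 : 0 < x) (h1 : x ≤ π) (M k : ℕ) :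
    |∑ j ∈ Finset.range k, Real.sin (((M + j + 1 : ℕ) : ℝ) * x) / ((M + j + 1 : ℕ) : ℝ)|
      ≤ π / (x * ((M + 1 : ℕ) : ℝ)) := by
  have hs : 0 < Real.sin (x / 2) :=
    Real.sin_pos_of_pos_of_lt_pi (by linarith) (by linarith [Real.pi_pos])
  have h := sin_series_tail_bound h0 h1 M k
  set S := ∑ j ∈ Finset.range k, Real.sin (((M + j + 1 : ℕ) : ℝ) * x) / ((M + j + 1 : ℕ) : ℝ)
  set A := Real.cos (((M + k : ℕ) + 1 / 2 : ℝ) * x)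
  have hA : |A| ≤ 1 := Real.abs_cos_le_one _
  set B := 1 / (2 * Real.sin (x / 2)) with hB
  have hBp : 0 < B := by positivity
  have h2 : |A / (2 * Real.sin (x / 2)) / ((M + k + 1 : ℕ) : ℝ)|
      ≤ B * (1 / ((M + k + 1 : ℕ) : ℝ)) := by
    rw [abs_div, abs_div, abs_of_pos (by positivity : 0 < 2 * Real.sin (x / 2)), Nat.abs_cast, hB,
      div_div, one_div_mul_one_div]
    gcongr
  have h3 : |S| ≤ B * (2 / ((M + 1 : ℕ) : ℝ)) := by
    have := abs_sub (S + A / (2 * Real.sin (x / 2)) / ((M + k + 1 : ℕ) : ℝ))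
      (A / (2 * Real.sin (x / 2)) / ((M + k + 1 : ℕ) : ℝ))
    rw [add_sub_cancel_right] at this
    linarith
  have h4 : B ≤ π / (2 * x) := by
    have := Real.mul_le_sin (x := x / 2) (by linarith) (by linarith)
    rw [hB, div_le_div_iff₀ (by positivity) (by positivity)]
    have h6 := mul_le_mul_of_nonneg_left this Real.pi_pos.le
    have e : π * (2 / π * (x / 2)) = x := by field_simp
    linarith
  calc |S| ≤ _ := h3
    _ ≤ π / (2 * x) * (2 / ((M + 1 : ℕ) : ℝ)) := by gcongr
    _ = _ := by field_simp

lemma sin_series_bound {x : ℝ} (h0 : 0 < x) (h1 : x ≤ π) (N : ℕ) :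
    |∑ j ∈ Finset.range N, Real.sin (((j + 1 : ℕ) : ℝ) * x) / ((j + 1 : ℕ) : ℝ)| ≤ 1 + π := by
  have small : ∀ M : ℕ, (M : ℝ) * x ≤ 1 →
      |∑ j ∈ Finset.range M, Real.sin (((j + 1 : ℕ) : ℝ) * x) / ((j + 1 : ℕ) : ℝ)| ≤ 1 := by
    intro M hM
    refine (Finset.abs_sum_le_sum_abs _ _).trans ?_
    refine (Finset.sum_le_sum (g := fun _ => x) fun j _ => ?_).trans (by simpa using hM)
    rw [abs_div, Nat.abs_cast, div_le_iff₀ (by positivity)]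
    refine Real.abs_sin_le_abs.trans ?_
    rw [abs_of_nonneg (by positivity)]
    linarith
  -- Up to `M` every term is at most `x`, and `M x ≤ 1`. Beyond `M` the tail bound gives `π`,
  -- because `x (M + 1) ≥ 1`.
  set M := ⌊1 / x⌋₊ with hM
  have hM1 : (M : ℝ) * x ≤ 1 := by
    have := Nat.floor_le (by positivity : 0 ≤ 1 / x)
    rwa [le_div_iff₀ h0] at this
  have hM2 : 1 ≤ x * ((M + 1 : ℕ) : ℝ) := by
    have := (Nat.lt_floor_add_one (1 / x)).le
    rw [div_le_iff₀ h0] at this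
    push_cast; linarith
  rcases le_total N M with h | h
  · have := small N (le_trans (by gcongr) hM1)
    linarith [Real.pi_pos]
  · obtain ⟨k, rfl⟩ := Nat.exists_eq_add_of_le h
    rw [Finset.sum_range_add]
    have h3 := sin_series_tail_bound' h0 h1 M k
    have h4 : π / (x * ((M + 1 : ℕ) : ℝ)) ≤ π :=
      div_le_self Real.pi_pos.le hM2
    refine (abs_add_le _ _).trans (add_le_add (small M hM1) (h3.trans h4))

/-! ### Truncated integrals -/

/-- Lebesgue measure on `ε < |β| ≤ π`, up to null sets. -/
def truncMeasure (ε : ℝ) : Measure ℝ :=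
  volume.restrict (Set.Ioc (-π) (-ε)) + volume.restrict (Set.Ioc ε π)

instance (ε : ℝ) : IsFiniteMeasure (truncMeasure ε) := by
  unfold truncMeasure; infer_instance

lemma ae_truncMeasure {ε : ℝ} (h0 : 0 < ε) :
    ∀ᵐ β ∂(truncMeasure ε), β ∈ punct ∧ ε ≤ |β| := by
  unfold truncMeasure
  rw [ae_add_measure_iff]
  constructor
  · refine (ae_restrict_iff' measurableSet_Ioc).2 (ae_of_all _ fun β hβ => ?_)
    have hn : β < 0 := lt_of_le_of_lt hβ.2 (by linarith)
    refine ⟨⟨hn.ne, ?_⟩, ?_⟩ <;> rw [abs_of_neg hn] <;> linarith [hβ.1, hβ.2]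
  · refine (ae_restrict_iff' measurableSet_Ioc).2 (ae_of_all _ fun β hβ => ?_)
    have hn : 0 < β := lt_trans h0 hβ.1
    refine ⟨⟨hn.ne', ?_⟩, ?_⟩ <;> rw [abs_of_pos hn] <;> linarith [hβ.1, hβ.2]

lemma integrable_truncMeasure_iff {ε : ℝ} (h1 : ε < π) {g : ℝ → ℂ} :
    Integrable g (truncMeasure ε) ↔
      IntervalIntegrable g volume (-π) (-ε) ∧ IntervalIntegrable g volume ε π := by
  unfold truncMeasure
  rw [integrable_add_measure, intervalIntegrable_iff_integrableOn_Ioc_of_le (by linarith),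
    intervalIntegrable_iff_integrableOn_Ioc_of_le h1.le]
  rfl

lemma integral_truncMeasure {ε : ℝ} (h1 : ε < π) {g : ℝ → ℂ}
    (hg : Integrable g (truncMeasure ε)) :
    ∫ β, g β ∂(truncMeasure ε) = truncIntegral g ε := by
  have h := hg
  unfold truncMeasure at h
  rw [integrable_add_measure] at h
  unfold truncIntegral truncMeasure
  rw [integral_add_measure h.1 h.2, intervalIntegral.integral_of_le (by linarith),
    intervalIntegral.integral_of_le h1.le]

lemma norm_div_den_le {ε : ℝ} (h0 : 0 < ε) {u : ℝ → ℂ} {C : ℝ} (hC : 0 ≤ C)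
    (hb : ∀ β ∈ punct, ‖u β‖ ≤ C) {β : ℝ} (hβ : β ∈ punct) (h : ε ≤ |β|) :
    ‖u β / den β‖ ≤ C / (2 / π * ε) := by
  rw [norm_div]
  have := abs_le_norm_den hβ.2
  exact div_le_div₀ hC (hb β hβ) (by positivity) (le_trans (by gcongr) this)

lemma integrable_div_den {ε : ℝ} (h0 : 0 < ε) {u : ℝ → ℂ} (hu : Measurable u) {C : ℝ}
    (hb : ∀ β ∈ punct, ‖u β‖ ≤ C) : Integrable (fun β => u β / den β) (truncMeasure ε) := by
  refine Integrable.of_bound (C := |C| / (2 / π * ε))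
    (hu.div measurable_den).aestronglyMeasurable ?_
  filter_upwards [ae_truncMeasure h0] with β hβ
  exact norm_div_den_le h0 (abs_nonneg C) (fun β h => (hb β h).trans (le_abs_self C)) hβ.1 hβ.2

/-- For an integrable function the principal value is the integral, since the primitive is
continuous at `0`. -/
lemma tendsto_truncIntegral_of_integrableOn {g : ℝ → ℂ} (hg : IntegrableOn g (Set.Ioc (-π) π)) :
    Tendsto (truncIntegral g) (𝓝[>] 0) (𝓝 (∫ β in (-π)..π, g β)) := by
  have hpi := Real.pi_pos
  have hi : IntervalIntegrable g volume (-π) π :=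
    (intervalIntegrable_iff_integrableOn_Ioc_of_le (by linarith)).2 hg
  have hc : ContinuousOn (fun x => ∫ t in (-π)..x, g t) (Set.uIcc (-π) π) :=
    intervalIntegral.continuousOn_primitive_interval' hi (by simp)
  have hc0 : ContinuousAt (fun x => ∫ t in (-π)..x, g t) 0 := by
    refine hc.continuousAt ?_
    rw [Set.uIcc_of_le (by linarith)]
    exact Icc_mem_nhds (by linarith) hpi
  have hl : Tendsto (fun ε : ℝ => ε) (𝓝[>] 0) (𝓝 0) := nhdsWithin_le_nhds
  have h1 := hc0.tendsto.comp hl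
  have h2 := hc0.tendsto.comp (by simpa using hl.neg : Tendsto (fun ε : ℝ => -ε) (𝓝[>] 0) (𝓝 0))
  have h3 := (h2.sub h1).add_const (∫ t in (-π)..π, g t)
  simp only [sub_self, zero_add] at h3
  refine h3.congr' ?_
  have hm : Set.Ioo (0 : ℝ) π ∈ 𝓝[>] (0 : ℝ) := Ioo_mem_nhdsGT hpi
  filter_upwards [hm] with ε hε
  have hsub : IntervalIntegrable g volume (-π) ε := hi.mono_set (by
    rw [Set.uIcc_of_le (by linarith [hε.1]), Set.uIcc_of_le (by linarith)]
    exact Set.Icc_subset_Icc_right hε.2.le)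
  simp only [Function.comp, truncIntegral]
  rw [← intervalIntegral.integral_interval_sub_left hi hsub]
  ring

/-! ### Principal values of exponentials -/

/-- The contributions at `±π` cancel by periodicity, leaving only those at `±ε`. -/
lemma truncIntegral_wave {Q : ℤ} (hQ : Q ≠ 0) (ε : ℝ) :
    truncIntegral (wave Q) ε = ((-2 * (Real.sin (Q * ε) / Q) : ℝ) : ℂ) := by
  have hQ' : (Q : ℂ) ≠ 0 := by exact_mod_cast hQ
  have hc : -(Complex.I * (Q : ℂ)) ≠ 0 := neg_ne_zero.2 (mul_ne_zero Complex.I_ne_zero hQ')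
  have e : wave Q = fun β : ℝ => Complex.exp (-(Complex.I * (Q : ℂ)) * (β : ℂ)) := by
    funext β; unfold wave; congr 1; ring
  have hper : Complex.exp (-(Complex.I * Q) * ((-π : ℝ) : ℂ))
      = Complex.exp (-(Complex.I * Q) * ((π : ℝ) : ℂ)) := by
    rw [Complex.exp_eq_exp_iff_exists_int]
    exact ⟨Q, by push_cast; ring⟩
  have e1 : Complex.exp (-(Complex.I * Q) * ((-ε : ℝ) : ℂ))
      = Complex.cos (Q * ε) + Complex.sin (Q * ε) * Complex.I := by
    rw [← Complex.exp_mul_I]; congr 1; push_cast; ring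
  have e2 : Complex.exp (-(Complex.I * Q) * (ε : ℂ))
      = Complex.cos (Q * ε) - Complex.sin (Q * ε) * Complex.I := by
    rw [show -(Complex.I * (Q : ℂ)) * (ε : ℂ) = (-(Q * ε) : ℂ) * Complex.I by ring,
      Complex.exp_mul_I, Complex.cos_neg, Complex.sin_neg]
    ring
  rw [truncIntegral, e, integral_exp_mul_complex hc, integral_exp_mul_complex hc, hper, e1, e2]
  push_cast
  field_simp
  ring

/-- The truncated integral of `e^{-iQβ} / (1 - e^{-iβ})`. -/
def waveInt (Q : ℤ) (ε : ℝ) : ℂ := ∫ β, wave Q β / den β ∂(truncMeasure ε)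

lemma integrable_wave_div_den {ε : ℝ} (h0 : 0 < ε) (Q : ℤ) :
    Integrable (fun β => wave Q β / den β) (truncMeasure ε) :=
  integrable_div_den h0 (measurable_wave Q) (C := 1) fun β _ => (norm_wave Q β).le

/-- `e^{-iQβ} - e^{-i(Q+1)β} = e^{-iQβ} den β`, so the denominator cancels and `waveInt` satisfies a
recursion in `Q`. -/
lemma waveInt_sub {ε : ℝ} (h0 : 0 < ε) (h1 : ε < π) (Q : ℤ) :
    waveInt Q ε - waveInt (Q + 1) ε = truncIntegral (wave Q) ε := by
  have hi : Integrable (wave Q) (truncMeasure ε) :=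
    Integrable.of_bound (C := 1) (measurable_wave Q).aestronglyMeasurable
      (ae_of_all _ fun β => (norm_wave Q β).le)
  rw [waveInt, waveInt, ← integral_sub (integrable_wave_div_den h0 _) (integrable_wave_div_den h0 _),
    ← integral_truncMeasure h1 hi]
  refine integral_congr_ae ?_
  filter_upwards [ae_truncMeasure h0] with β hβ
  have := den_ne_zero hβ.1
  field_simp
  rw [wave_add, den_eq]; ring

/-- `(1 + e^{-iβ})/(1 - e^{-iβ})` is odd. Together with the recursion this fixes the starting value.
-/
lemma waveInt_zero_add_one {ε : ℝ} (h0 : 0 < ε) (h1 : ε < π) :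
    waveInt 0 ε + waveInt 1 ε = 0 := by
  have hi := (integrable_wave_div_den h0 0).add (integrable_wave_div_den h0 1)
  rw [waveInt, waveInt, ← integral_add (integrable_wave_div_den h0 _) (integrable_wave_div_den h0 _)]
  set h : ℝ → ℂ := fun β => wave 0 β / den β + wave 1 β / den β with hh
  have e1 := integral_truncMeasure h1 (g := h) hi
  have hodd : ∀ β ∈ punct, h (-β) = - h β := by
    intro β hβ
    have hd := den_ne_zero hβ
    have hd' : den (-β) ≠ 0 := den_ne_zero ⟨neg_ne_zero.2 hβ.1, by rw [abs_neg]; exact hβ.2⟩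
    have hw : wave 1 (-β) * wave 1 β = 1 := by
      unfold wave; rw [← Complex.exp_add]; simp
    rw [den_eq] at hd hd'
    simp only [hh, wave_zero, den_eq]
    generalize wave 1 β = x at *
    generalize wave 1 (-β) = y at *
    rw [← add_div, ← add_div, ← neg_div, div_eq_div_iff hd' hd]
    linear_combination (-2 : ℂ) * hw
  rw [e1, truncIntegral]
  have e2 : ∫ β in (-π)..(-ε), h β = ∫ β in ε..π, h (-β) := by
    rw [intervalIntegral.integral_comp_neg]
  have e3 : ∫ β in ε..π, h (-β) = ∫ β in ε..π, -h β := by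
    refine intervalIntegral.integral_congr fun β hβ => ?_
    rw [Set.uIcc_of_le h1.le] at hβ
    refine hodd β ⟨(lt_of_lt_of_le h0 hβ.1).ne', ?_⟩
    rw [abs_of_pos (lt_of_lt_of_le h0 hβ.1)]; exact hβ.2
  rw [e2, e3, intervalIntegral.integral_neg]
  ring

lemma waveInt_one {ε : ℝ} (h0 : 0 < ε) (h1 : ε < π) :
    waveInt 1 ε = ((-(π - ε) : ℝ) : ℂ) := by
  have h2 := waveInt_sub h0 h1 0
  have h3 := waveInt_zero_add_one h0 h1
  have h4 : truncIntegral (wave 0) ε = ((2 * (π - ε) : ℝ) : ℂ) := by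
    rw [wave_zero, truncIntegral, intervalIntegral.integral_const, intervalIntegral.integral_const]
    simp
    ring
  rw [zero_add, h4] at h2
  push_cast at h2 ⊢
  linear_combination (1 / 2 : ℂ) * h3 - (1 / 2 : ℂ) * h2

/-- `∑_{j=1}^{N} sin(jε) / j`. -/
def sinSum (N : ℕ) (ε : ℝ) : ℝ :=
  ∑ j ∈ Finset.range N, Real.sin (((j + 1 : ℕ) : ℝ) * ε) / ((j + 1 : ℕ) : ℝ)

lemma waveInt_pos {ε : ℝ} (h0 : 0 < ε) (h1 : ε < π) (N : ℕ) :
    waveInt (N + 1) ε = ((-(π - ε) + 2 * sinSum N ε : ℝ) : ℂ) := by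
  induction N with
  | zero => simpa [sinSum] using waveInt_one h0 h1
  | succ N ih =>
    have h2 := waveInt_sub h0 h1 ((N : ℤ) + 1)
    rw [ih, truncIntegral_wave (by omega)] at h2
    rw [sinSum, Finset.sum_range_succ, ← sinSum]
    push_cast at h2 ⊢
    linear_combination -h2

lemma waveInt_nonpos {ε : ℝ} (h0 : 0 < ε) (h1 : ε < π) (N : ℕ) :
    waveInt (-N) ε = (((π - ε) - 2 * sinSum N ε : ℝ) : ℂ) := by
  induction N with
  | zero =>
    have h3 := waveInt_zero_add_one h0 h1
    rw [waveInt_one h0 h1] at h3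
    simp only [sinSum, Nat.cast_zero, neg_zero, Finset.range_zero, Finset.sum_empty]
    push_cast at h3 ⊢
    linear_combination h3
  | succ N ih =>
    have h2 := waveInt_sub h0 h1 (-((N : ℤ) + 1))
    rw [show -((N : ℤ) + 1) + 1 = -N by ring, ih, truncIntegral_wave (by omega)] at h2
    rw [sinSum, Finset.sum_range_succ, ← sinSum]
    push_cast at h2 ⊢
    have e : Complex.sin ((-1 + -(N : ℂ)) * (ε : ℂ)) / (-1 + -(N : ℂ))
        = Complex.sin (((N : ℂ) + 1) * (ε : ℂ)) / ((N : ℂ) + 1) := by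
      rw [show (-1 + -(N : ℂ)) = -((N : ℂ) + 1) by ring, neg_mul, Complex.sin_neg, neg_div_neg_eq]
    have e' : Complex.sin (-((N : ℂ) + 1) * (ε : ℂ)) / -((N : ℂ) + 1)
        = Complex.sin (((N : ℂ) + 1) * (ε : ℂ)) / ((N : ℂ) + 1) := by
      rw [neg_mul, Complex.sin_neg, neg_div_neg_eq]
    simp only [neg_add_rev] at h2 ⊢
    rw [e] at h2
    linear_combination h2

/-- One formula for both signs of `Q`: `σ = 1` for `Q ≤ 0` and `σ = -1` for `Q > 0`. -/
lemma exists_waveInt_eq (Q : ℤ) : ∃ (N : ℕ) (σ : ℝ), |σ| = 1 ∧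
    ∀ ε, 0 < ε → ε < π → waveInt Q ε = ((σ * ((π - ε) - 2 * sinSum N ε) : ℝ) : ℂ) := by
  rcases le_or_gt Q 0 with h | h
  · refine ⟨Q.natAbs, 1, by simp, fun ε h0 h1 => ?_⟩
    have := waveInt_nonpos h0 h1 Q.natAbs
    rw [show (-(Q.natAbs : ℤ)) = Q by omega] at this
    rw [this, one_mul]
  · refine ⟨(Q - 1).natAbs, -1, by simp, fun ε h0 h1 => ?_⟩
    have := waveInt_pos h0 h1 (Q - 1).natAbs
    rw [show (((Q - 1).natAbs : ℤ) + 1) = Q by omega] at this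
    rw [this]; congr 1; ring

/-- Uniform in `Q` and `ε`: `π` plus twice the bound `1 + π` on the sine sums. It serves only as a
dominating constant and never enters the final estimates. -/
lemma norm_waveInt_le (Q : ℤ) {ε : ℝ} (h0 : 0 < ε) (h1 : ε < π) : ‖waveInt Q ε‖ ≤ 3 * π + 2 := by
  obtain ⟨N, σ, hσ, h⟩ := exists_waveInt_eq Q
  rw [h ε h0 h1, Complex.norm_real, Real.norm_eq_abs, abs_mul, hσ, one_mul]
  have := sin_series_bound h0 h1.le N
  have h2 := abs_le.1 this
  rw [← sinSum] at h2
  exact abs_le.2 ⟨by linarith [h2.2], by linarith [h2.1]⟩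

/-- For fixed `Q` the finite sine sum vanishes as `ε → 0`, so the limit is `±π`. This sharper
constant is the one that enters `a_n`. -/
lemma tendsto_waveInt (Q : ℤ) :
    ∃ L : ℂ, ‖L‖ ≤ π ∧ Tendsto (waveInt Q) (𝓝[>] 0) (𝓝 L) := by
  obtain ⟨N, σ, hσ, h⟩ := exists_waveInt_eq Q
  refine ⟨((σ * π : ℝ) : ℂ), ?_, ?_⟩
  · rw [Complex.norm_real, Real.norm_eq_abs, abs_mul, hσ, one_mul, abs_of_pos Real.pi_pos]
  · have hc : Continuous fun ε : ℝ => ((σ * ((π - ε) - 2 * sinSum N ε) : ℝ) : ℂ) := by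
      unfold sinSum; fun_prop
    have h2 := (hc.tendsto 0).mono_left (nhdsWithin_le_nhds (s := Set.Ioi 0))
    have e : ((σ * ((π - 0) - 2 * sinSum N 0) : ℝ) : ℂ) = ((σ * π : ℝ) : ℂ) := by
      simp [sinSum]
    rw [e] at h2
    refine h2.congr' ?_
    filter_upwards [Ioo_mem_nhdsGT Real.pi_pos] with ε hε
    rw [h ε hε.1 hε.2]

/-! ### Modes -/

/-- The absolutely convex hull of the functions `e^{-iQβ} (β / (1 - e^{-iβ}))^r`, `r ≤ n`. -/
inductive Mode (n : ℕ) : (ℝ → ℂ) → Prop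
  | basic (Q : ℤ) (r : ℕ) (hr : r ≤ n) : Mode n fun β => wave Q β * quot β ^ r
  | comb (a b : ℂ) (u v : ℝ → ℂ) (hab : ‖a‖ + ‖b‖ ≤ 1) (hu : Mode n u) (hv : Mode n v) :
      Mode n fun β => a * u β + b * v β

lemma Mode.mono {m n : ℕ} (h : m ≤ n) {u : ℝ → ℂ} (hu : Mode m u) : Mode n u := by
  induction hu with
  | basic Q r hr => exact .basic Q r (hr.trans h)
  | comb a b u v hab _ _ hu hv => exact .comb a b u v hab hu hv

lemma Mode.smul {n : ℕ} {u : ℝ → ℂ} (hu : Mode n u) {a : ℂ} (ha : ‖a‖ ≤ 1) :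
    Mode n fun β => a * u β := by
  simpa using Mode.comb a 0 u u (by simpa using ha) hu hu

/-- Bilinearity reduces the claim to generators, whose frequencies and exponents add. -/
lemma Mode.mul {m n : ℕ} {u v : ℝ → ℂ} (hu : Mode m u) (hv : Mode n v) :
    Mode (m + n) fun β => u β * v β := by
  induction hu with
  | basic Q r hr =>
    induction hv with
    | basic P q hq =>
      convert Mode.basic (n := m + n) (Q + P) (r + q) (by omega) using 2 with β
      rw [wave_add, pow_add]; ring
    | comb a b u v hab _ _ hu hv =>
      convert Mode.comb a b _ _ hab hu hv using 2 with β
      ring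
  | comb a b u v hab _ _ hu hv =>
    convert Mode.comb a b _ _ hab hu hv using 2 with β
    ring

lemma mode_one : Mode 0 fun _ => 1 := by
  simpa [wave_zero] using Mode.basic (n := 0) 0 0 le_rfl

lemma mode_wave (Q : ℤ) : Mode 0 (wave Q) := by
  simpa using Mode.basic (n := 0) Q 0 le_rfl

lemma Mode.measurable {n : ℕ} {u : ℝ → ℂ} (hu : Mode n u) : Measurable u := by
  induction hu with
  | basic Q r hr => exact (measurable_wave Q).mul (measurable_quot.pow_const r)
  | comb a b u v hab _ _ hu hv => exact (hu.const_mul a).add (hv.const_mul b)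

lemma norm_comb_le {a b x y : ℂ} {C : ℝ} (hC : 0 ≤ C) (hab : ‖a‖ + ‖b‖ ≤ 1) (hx : ‖x‖ ≤ C)
    (hy : ‖y‖ ≤ C) : ‖a * x + b * y‖ ≤ C := by
  calc ‖a * x + b * y‖ ≤ ‖a‖ * ‖x‖ + ‖b‖ * ‖y‖ := by
        simpa only [norm_mul] using norm_add_le (a * x) (b * y)
    _ ≤ ‖a‖ * C + ‖b‖ * C := by gcongr
    _ = (‖a‖ + ‖b‖) * C := by ring
    _ ≤ 1 * C := by gcongr
    _ = C := one_mul C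

lemma one_le_pi_div_two : (1 : ℝ) ≤ π / 2 := by linarith [Real.pi_gt_three]

lemma Mode.norm_le {n : ℕ} {u : ℝ → ℂ} (hu : Mode n u) {β : ℝ} (hβ : β ∈ punct) :
    ‖u β‖ ≤ (π / 2) ^ n := by
  induction hu with
  | basic Q r hr =>
    rw [norm_mul, norm_wave, one_mul, norm_pow]
    exact (pow_le_pow_left₀ (norm_nonneg _) (norm_quot_le hβ) r).trans
      (pow_le_pow_right₀ one_le_pi_div_two hr)
  | comb a b u v hab _ _ hu hv => exact norm_comb_le (by positivity) hab hu hv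

/-- The truncated integral of `u(β) / (1 - e^{-iβ})`. -/
def modeInt (u : ℝ → ℂ) (ε : ℝ) : ℂ := ∫ β, u β / den β ∂(truncMeasure ε)

lemma Mode.integrable {n : ℕ} {u : ℝ → ℂ} (hu : Mode n u) {ε : ℝ} (h0 : 0 < ε) :
    Integrable (fun β => u β / den β) (truncMeasure ε) :=
  integrable_div_den h0 hu.measurable fun _ => hu.norm_le

/-- Factor `a^r - b^r` with `b = -i`, the limit of `quot` at the origin; each of the `r` summands is
at most `(π/2)^{r-1}`. -/
lemma norm_quot_pow_sub_le (r : ℕ) {β : ℝ} (hβ : β ∈ punct) :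
    ‖quot β ^ r - (-Complex.I) ^ r‖ ≤ r * (π / 2) ^ (r - 1) * ‖quot β + Complex.I‖ := by
  have h := Commute.geom_sum₂_mul (Commute.all (quot β) (-Complex.I)) r
  rw [← h, norm_mul, sub_neg_eq_add]
  refine mul_le_mul_of_nonneg_right ?_ (norm_nonneg _)
  refine (norm_sum_le _ _).trans ?_
  refine (Finset.sum_le_sum (g := fun _ => (π / 2) ^ (r - 1)) fun i hi => ?_).trans (by simp)
  rw [norm_mul, norm_pow, norm_pow, norm_neg, Complex.norm_I, one_pow, mul_one]
  exact (pow_le_pow_left₀ (norm_nonneg _) (norm_quot_le hβ) i).trans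
    (pow_le_pow_right₀ one_le_pi_div_two (by have := Finset.mem_range.1 hi; omega))

/-- The remainder `e^{-iQβ} ((β / (1 - e^{-iβ}))^r - (-i)^r) / (1 - e^{-iβ})`. -/
def modeRem (Q : ℤ) (r : ℕ) (β : ℝ) : ℂ :=
  wave Q β * (quot β ^ r - (-Complex.I) ^ r) / den β

lemma measurable_modeRem (Q : ℤ) (r : ℕ) : Measurable (modeRem Q r) :=
  ((measurable_wave Q).mul ((measurable_quot.pow_const r).sub_const _)).div measurable_den

lemma norm_modeRem_le (Q : ℤ) (r : ℕ) {β : ℝ} (hβ : |β| ≤ π) :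
    ‖modeRem Q r β‖ ≤ r * (π / 2) ^ (r - 1) * quotMajorant β := by
  rcases eq_or_ne β 0 with h | h
  -- At the origin `den` vanishes, and division by zero makes `modeRem` equal to `0`.
  · subst h
    simpa [modeRem, den] using mul_nonneg (by positivity) (quotMajorant_nonneg hβ)
  · have hp : β ∈ punct := ⟨h, hβ⟩
    rw [modeRem, norm_div, norm_mul, norm_wave, one_mul]
    calc _ ≤ r * (π / 2) ^ (r - 1) * ‖quot β + Complex.I‖ / ‖den β‖ := by
          gcongr; exact norm_quot_pow_sub_le r hp
      _ = r * (π / 2) ^ (r - 1) * (‖quot β + Complex.I‖ / ‖den β‖) := by ring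
      _ ≤ _ := by gcongr; exact norm_quot_add_I_div_le hp

lemma integrableOn_modeRem (Q : ℤ) (r : ℕ) : IntegrableOn (modeRem Q r) (Set.Ioc (-π) π) := by
  refine Integrable.mono' (integrableOn_quotMajorant.const_mul (r * (π / 2) ^ (r - 1)))
    (measurable_modeRem Q r).aestronglyMeasurable ?_
  refine (ae_restrict_iff' measurableSet_Ioc).2 (ae_of_all _ fun β hβ => ?_)
  exact norm_modeRem_le Q r (abs_le.2 ⟨hβ.1.le, hβ.2⟩)

lemma truncMeasure_le {ε : ℝ} (h0 : 0 < ε) (h1 : ε < π) :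
    truncMeasure ε ≤ volume.restrict (Set.Ioc (-π) π) := by
  have hd : Disjoint (Set.Ioc (-π) (-ε)) (Set.Ioc ε π) :=
    Set.disjoint_left.2 fun x hx hy => by linarith [hx.2, hy.1]
  rw [truncMeasure, ← Measure.restrict_union hd measurableSet_Ioc]
  exact Measure.restrict_mono (Set.union_subset (Set.Ioc_subset_Ioc_right (by linarith))
    (Set.Ioc_subset_Ioc_left (by linarith))) le_rfl

lemma norm_integral_modeRem_le {Q : ℤ} {r : ℕ} {μ : Measure ℝ}
    (hμ : μ ≤ volume.restrict (Set.Ioc (-π) π)) :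
    ‖∫ β, modeRem Q r β ∂μ‖ ≤ π * (aCoef r - 1) := by
  have hi := integrableOn_quotMajorant.const_mul (r * (π / 2) ^ (r - 1))
  have hae : ∀ᵐ β ∂(volume.restrict (Set.Ioc (-π) π)), |β| ≤ π :=
    (ae_restrict_iff' measurableSet_Ioc).2 (ae_of_all _ fun β hβ => abs_le.2 ⟨hβ.1.le, hβ.2⟩)
  calc _ ≤ ∫ β, r * (π / 2) ^ (r - 1) * quotMajorant β ∂μ := by
        refine norm_integral_le_of_norm_le (hi.mono_measure hμ) ?_
        filter_upwards [ae_mono hμ hae] with β hβ using norm_modeRem_le Q r hβ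
    _ ≤ ∫ β in Set.Ioc (-π) π, r * (π / 2) ^ (r - 1) * quotMajorant β := by
        refine integral_mono_measure hμ ?_ hi
        filter_upwards [hae] with β hβ
        exact mul_nonneg (by positivity) (quotMajorant_nonneg hβ)
    _ = _ := by
        rw [integral_const_mul, ← intervalIntegral.integral_of_le (by linarith [Real.pi_pos]),
          integral_quotMajorant, aCoef]
        ring

lemma modeInt_basic (Q : ℤ) (r : ℕ) {ε : ℝ} (h0 : 0 < ε) (h1 : ε < π) :
    modeInt (fun β => wave Q β * quot β ^ r) ε
      = (-Complex.I) ^ r * waveInt Q ε + ∫ β, modeRem Q r β ∂(truncMeasure ε) := by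
  rw [modeInt, waveInt, ← integral_const_mul, ← integral_add
    ((integrable_wave_div_den h0 Q).const_mul _)
    (Integrable.mono_measure (integrableOn_modeRem Q r) (truncMeasure_le h0 h1))]
  refine integral_congr_ae (ae_of_all _ fun β => ?_)
  simp only [modeRem]
  ring

lemma modeInt_comb {n : ℕ} {u v : ℝ → ℂ} (hu : Mode n u) (hv : Mode n v) (a b : ℂ) {ε : ℝ}
    (h0 : 0 < ε) :
    modeInt (fun β => a * u β + b * v β) ε = a * modeInt u ε + b * modeInt v ε := by
  rw [modeInt, modeInt, modeInt, ← integral_const_mul, ← integral_const_mul,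
    ← integral_add ((hu.integrable h0).const_mul _) ((hv.integrable h0).const_mul _)]
  refine integral_congr_ae (ae_of_all _ fun β => ?_)
  simp only []
  ring

/-- Independent of `ε` and of the mode, as dominated convergence over all modes requires. -/
lemma Mode.norm_modeInt_le {n : ℕ} {u : ℝ → ℂ} (hu : Mode n u) {ε : ℝ} (h0 : 0 < ε) (h1 : ε < π) :
    ‖modeInt u ε‖ ≤ 3 * π + 2 + π * aCoef n := by
  have := aCoef_pos n
  induction hu with
  | basic Q r hr =>
    rw [modeInt_basic Q r h0 h1]
    refine (norm_add_le _ _).trans (add_le_add ?_ ?_)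
    · rw [norm_mul, norm_pow, norm_neg, Complex.norm_I, one_pow, one_mul]
      exact norm_waveInt_le Q h0 h1
    · refine (norm_integral_modeRem_le (truncMeasure_le h0 h1)).trans ?_
      have := aCoef_mono hr
      gcongr; linarith
  | comb a b u v hab hu hv hu' hv' =>
    rw [modeInt_comb hu hv a b h0]
    exact norm_comb_le (by positivity) hab hu' hv'

/-- On generators, `π` comes from the pure exponential and `π (a_r - 1)` from the integrable
remainder. The bound then passes to absolutely convex combinations. -/
lemma Mode.tendsto_modeInt {n : ℕ} {u : ℝ → ℂ} (hu : Mode n u) :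
    ∃ L : ℂ, ‖L‖ ≤ π * aCoef n ∧ Tendsto (modeInt u) (𝓝[>] 0) (𝓝 L) := by
  have hn := aCoef_pos n
  have hm : Set.Ioo (0 : ℝ) π ∈ 𝓝[>] (0 : ℝ) := Ioo_mem_nhdsGT Real.pi_pos
  induction hu with
  | basic Q r hr =>
    obtain ⟨L, hL, ht⟩ := tendsto_waveInt Q
    refine ⟨(-Complex.I) ^ r * L + ∫ β in (-π)..π, modeRem Q r β, ?_, ?_⟩
    · have h1 : ‖(-Complex.I) ^ r * L‖ ≤ π := by
        rw [norm_mul, norm_pow, norm_neg, Complex.norm_I, one_pow, one_mul]; exact hL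
      have h2 : ‖∫ β in (-π)..π, modeRem Q r β‖ ≤ π * (aCoef r - 1) := by
        rw [intervalIntegral.integral_of_le (by linarith [Real.pi_pos])]
        exact norm_integral_modeRem_le le_rfl
      have h3 := mul_le_mul_of_nonneg_left (aCoef_mono hr) Real.pi_pos.le
      refine (norm_add_le _ _).trans ?_
      linarith
    · refine ((ht.const_mul ((-Complex.I) ^ r)).add
        (tendsto_truncIntegral_of_integrableOn (integrableOn_modeRem Q r))).congr' ?_
      filter_upwards [hm] with ε hε
      rw [modeInt_basic Q r hε.1 hε.2, integral_truncMeasure hε.2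
        (Integrable.mono_measure (integrableOn_modeRem Q r) (truncMeasure_le hε.1 hε.2))]
  | comb a b u v hab hu hv hu' hv' =>
    obtain ⟨L, hL, ht⟩ := hu'
    obtain ⟨L', hL', ht'⟩ := hv'
    refine ⟨a * L + b * L', norm_comb_le (by positivity) hab hL hL',
      ((ht.const_mul a).add (ht'.const_mul b)).congr' ?_⟩
    filter_upwards [hm] with ε hε
    rw [modeInt_comb hu hv a b hε.1]

/-! ### The averages of exponentials -/

/-- The mean of `e^{-iqβ}` over `0 ≤ q < p`. -/
def waveAvg (p : ℕ) (β : ℝ) : ℂ := (1 / p : ℂ) * ∑ q ∈ Finset.range p, wave q β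

/-- Each mean is a convex combination of the preceding mean and one new exponential. -/
lemma mode_waveAvg (p : ℕ) : Mode 0 (waveAvg (p + 1)) := by
  induction p with
  | zero =>
    convert mode_wave 0 using 1
    funext β
    simp [waveAvg]
  | succ p ih =>
    convert Mode.comb ((((p + 1 : ℝ) / (p + 2) : ℝ)) : ℂ) (((1 / (p + 2) : ℝ)) : ℂ) _ _ ?_ ih
      (mode_wave ((p + 1 : ℕ) : ℤ)) using 2 with β
    · rw [waveAvg, waveAvg, Finset.sum_range_succ _ (p + 1)]
      have h1 : (p : ℂ) + 1 ≠ 0 := by exact_mod_cast Nat.succ_ne_zero p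
      have h2 : (p : ℂ) + 2 ≠ 0 := by exact_mod_cast Nat.succ_ne_zero (p + 1)
      push_cast
      have h3 : (p : ℂ) + 1 + 1 ≠ 0 := by rw [add_assoc]; norm_num [h2]
      field_simp
      ring
    · rw [Complex.norm_real, Complex.norm_real, Real.norm_of_nonneg (by positivity),
        Real.norm_of_nonneg (by positivity)]
      have : (p : ℝ) + 2 ≠ 0 := by positivity
      field_simp
      linarith

lemma den_mul_sum_wave (p : ℕ) (β : ℝ) :
    den β * ∑ q ∈ Finset.range p, wave q β = 1 - wave p β := by
  induction p with
  | zero => simp [wave_zero]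
  | succ p ih =>
    rw [Finset.sum_range_succ, mul_add, ih, den_eq]
    have := wave_add p 1 β
    push_cast
    rw [this]; ring

lemma integral_wave_avg {p : ℤ} (hp : p ≠ 0) {β : ℝ} (hβ : β ≠ 0) :
    ∫ τ in (0 : ℝ)..1, Complex.exp (Complex.I * (p * ((τ - 1) * β : ℝ) : ℂ))
      = (1 - wave p β) / (Complex.I * p * β) := by
  have hp' : (p : ℂ) ≠ 0 := by exact_mod_cast hp
  have hβ' : (β : ℂ) ≠ 0 := by exact_mod_cast hβ
  have hc : Complex.I * p * β ≠ 0 := mul_ne_zero (mul_ne_zero Complex.I_ne_zero hp') hβ'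
  have e : ∀ τ : ℝ, Complex.exp (Complex.I * (p * ((τ - 1) * β : ℝ) : ℂ))
      = wave p β * Complex.exp (Complex.I * p * β * (τ : ℂ)) := by
    intro τ; unfold wave; rw [← Complex.exp_add]; congr 1; push_cast; ring
  simp_rw [e]
  rw [intervalIntegral.integral_const_mul, integral_exp_mul_complex hc]
  have : wave p β * Complex.exp (Complex.I * p * β * ((1 : ℝ) : ℂ)) = 1 := by
    unfold wave; rw [← Complex.exp_add]; simp; ring_nf; simp
  rw [mul_div_assoc', mul_sub, this]
  simp

/-- The factor `quot` supplies the `β` and the `1/den` that turn `(1 - e^{-ipβ})/(ipβ)` into `-i`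
times a mean of exponentials. Only `p = 0` keeps a power of `quot`. -/
lemma exists_mode_avg (p : ℤ) : ∃ u, Mode 1 u ∧ ∀ β ∈ punct,
    quot β * ∫ τ in (0 : ℝ)..1, Complex.exp (Complex.I * (p * ((τ - 1) * β : ℝ) : ℂ)) = u β := by
  have pos : ∀ m : ℕ, ∀ β ∈ punct, quot β * ((1 - wave (m + 1 : ℕ) β) /
      (Complex.I * (m + 1 : ℕ) * β)) = -Complex.I * waveAvg (m + 1) β := by
    intro m β hβ
    have hd := den_ne_zero hβ
    have hb : (β : ℂ) ≠ 0 := by exact_mod_cast hβ.1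
    have hm : (m : ℂ) + 1 ≠ 0 := by exact_mod_cast Nat.succ_ne_zero m
    rw [← den_mul_sum_wave, waveAvg, quot]
    push_cast
    have hI := Complex.I_ne_zero
    field_simp
    linear_combination (∑ q ∈ Finset.range (m + 1), wave q β) * Complex.I_sq
  rcases lt_trichotomy p 0 with h | h | h
  · obtain ⟨m, hm⟩ : ∃ m : ℕ, p = -((m + 1 : ℕ) : ℤ) := ⟨(-p - 1).toNat, by push_cast; omega⟩
    refine ⟨_, (((mode_wave p).mul (mode_waveAvg m)).smul (a := -Complex.I) (by simp)).mono
      (Nat.zero_le 1), fun β hβ => ?_⟩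
    rw [integral_wave_avg h.ne hβ.1]
    have hw : wave p β * wave ((m + 1 : ℕ) : ℤ) β = 1 := by
      rw [← wave_add, hm, neg_add_cancel, wave_zero]
    have := pos m β hβ
    have e : (1 - wave p β) / (Complex.I * p * β)
        = wave p β * ((1 - wave (m + 1 : ℕ) β) / (Complex.I * (m + 1 : ℕ) * β)) := by
      rw [mul_div_assoc', mul_sub, hw, hm]
      push_cast
      rw [← neg_div_neg_eq]
      congr 1 <;> ring
    rw [e, mul_left_comm, this]
    ring
  · subst h
    refine ⟨_, .basic 0 1 le_rfl, fun β hβ => ?_⟩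
    simp [wave_zero]
  · obtain ⟨m, hm⟩ : ∃ m : ℕ, p = ((m + 1 : ℕ) : ℤ) := ⟨(p - 1).toNat, by push_cast; omega⟩
    refine ⟨_, ((mode_waveAvg m).smul (a := -Complex.I) (by simp)).mono (Nat.zero_le 1),
      fun β hβ => ?_⟩
    rw [integral_wave_avg h.ne' hβ.1, hm, ← pos m β hβ]
    push_cast
    rfl

section

/-! ### Fourier series -/

/-- The exponential `e^{iKα}`. -/
def osc (K : ℤ) (α : ℝ) : ℂ := Complex.exp (Complex.I * (K * α : ℂ))

lemma norm_osc (K : ℤ) (α : ℝ) : ‖osc K α‖ = 1 := by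
  have : osc K α = Complex.exp (((K * α : ℝ) : ℂ) * Complex.I) := by
    unfold osc; congr 1; push_cast; ring
  rw [this, Complex.norm_exp_ofReal_mul_I]

lemma osc_zero (α : ℝ) : osc 0 α = 1 := by simp [osc]

lemma osc_add (P Q : ℤ) (α : ℝ) : osc (P + Q) α = osc P α * osc Q α := by
  unfold osc; rw [← Complex.exp_add]; congr 1; push_cast; ring

lemma osc_add_right (K : ℤ) (α β : ℝ) : osc K (α + β) = osc K α * osc K β := by
  unfold osc; rw [← Complex.exp_add]; congr 1; push_cast; ring

lemma osc_sub_right (K : ℤ) (α β : ℝ) : osc K (α - β) = osc K α * wave K β := by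
  unfold osc wave; rw [← Complex.exp_add]; congr 1; push_cast; ring

lemma continuous_osc (K : ℤ) : Continuous (osc K) := by
  unfold osc; fun_prop

lemma osc_periodic (K : ℤ) (α : ℝ) : osc K (α + 2 * π) = osc K α := by
  unfold osc
  rw [Complex.exp_eq_exp_iff_exists_int]
  exact ⟨K, by push_cast; ring⟩

lemma integral_osc (K : ℤ) : ∫ x in (-π)..π, osc K x = if K = 0 then 2 * (π : ℂ) else 0 := by
  split_ifs with h
  · subst h
    simp only [osc_zero, intervalIntegral.integral_const]
    simp; ring
  · have hK : Complex.I * (K : ℂ) ≠ 0 := mul_ne_zero Complex.I_ne_zero (by exact_mod_cast h)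
    have e : osc K = fun x : ℝ => Complex.exp (Complex.I * (K : ℂ) * (x : ℂ)) := by
      funext x; unfold osc; congr 1; ring
    rw [e, integral_exp_mul_complex hK, div_eq_zero_iff]
    left
    rw [sub_eq_zero, Complex.exp_eq_exp_iff_exists_int]
    exact ⟨K, by push_cast; ring⟩

lemma fhat_eq (g : ℝ → ℂ) (k : ℤ) :
    fhat g k = 1 / (2 * (π : ℂ)) * ∫ x in (-π)..π, osc (-k) x * g x := by
  rw [fhat, fourierCoeffOn_eq_integral]
  have e : ∀ x : ℝ, (fourier (-k) : C(AddCircle (π - -π), ℂ)) (x : AddCircle (π - -π))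
      = osc (-k) x := by
    intro x
    rw [fourier_coe_apply, osc]
    congr 1
    have : (π : ℂ) ≠ 0 := by exact_mod_cast Real.pi_ne_zero
    push_cast
    field_simp
    ring
  simp_rw [e]
  rw [Complex.real_smul]
  simp only [smul_eq_mul]
  congr 1
  push_cast
  ring

instance : Fact (0 < 2 * π) := ⟨by positivity⟩

lemma MemF.summable_fhat {ν : ℝ} (hν : 0 ≤ ν) {g : ℝ → ℂ} (hg : MemF ν g) :
    Summable (fhat g) := by
  refine Summable.of_norm_bounded hg.summable fun k => ?_
  have : 1 ≤ Real.exp (ν * |(k : ℝ)|) := Real.one_le_exp (by positivity)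
  exact le_mul_of_one_le_left (norm_nonneg _) this

/-- The function descends to a continuous function on the circle with summable Fourier coefficients,
so its Fourier series converges to it at every point. -/
lemma MemF.hasSum {ν : ℝ} (hν : 0 ≤ ν) {g : ℝ → ℂ} (hg : MemF ν g) (α : ℝ) :
    HasSum (fun k : ℤ => fhat g k * osc k α) (g α) := by
  let G : C(AddCircle (2 * π), ℂ) :=
    ⟨hg.periodic.lift, continuous_coinduced_dom.2 hg.continuous⟩
  have hG : ∀ x : ℝ, G (x : AddCircle (2 * π)) = g x := fun x => hg.periodic.lift_coe x
  have eo : ∀ (k : ℤ) (x : ℝ), (fourier k : C(AddCircle (2 * π), ℂ)) (x : AddCircle (2 * π))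
      = osc k x := by
    intro k x
    rw [fourier_coe_apply, osc]
    congr 1
    have : (π : ℂ) ≠ 0 := by exact_mod_cast Real.pi_ne_zero
    push_cast
    field_simp
  have hc : ∀ k, fourierCoeff G k = fhat g k := by
    intro k
    rw [fourierCoeff_eq_intervalIntegral _ _ (-π), fhat_eq, Complex.real_smul]
    simp_rw [eo, hG]
    rw [show -π + 2 * π = π by ring]
    simp
  have hs : Summable (fourierCoeff G) := by
    rw [funext hc]; exact hg.summable_fhat hν
  have h := has_pointwise_sum_fourier_series_of_summable hs (α : AddCircle (2 * π))
  simp_rw [hc, eo, hG] at h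
  exact h

/-! ### Absolutely convergent expansions -/

/-- The weight `e^{ν|k|}`. -/
def ewt (ν : ℝ) (k : ℤ) : ℝ≥0∞ := ENNReal.ofReal (Real.exp (ν * |(k : ℝ)|))

lemma one_le_ewt {ν : ℝ} (hν : 0 ≤ ν) (k : ℤ) : 1 ≤ ewt ν k := by
  rw [ewt, ENNReal.one_le_ofReal]
  exact Real.one_le_exp (by positivity)

lemma ewt_add_le {ν : ℝ} (hν : 0 ≤ ν) (j k : ℤ) : ewt ν (j + k) ≤ ewt ν j * ewt ν k := by
  rw [ewt, ewt, ewt, ← ENNReal.ofReal_mul (Real.exp_nonneg _), ← Real.exp_add, ← mul_add]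
  gcongr
  push_cast
  exact abs_add_le _ _

/-- `F(α, β) = ∑_i c_i e^{iK_iα} u_i(β)` for `β` in the punctured interval, where the `u_i` lie in
a class `𝒰` and each `K_i` is the sum of a multiset `M_i` of `N` integers, with the bounds
`∑ e^{ν|K_i|} |c_i| ≤ X` and `∑ e^{ν|K_i|} (∑_{k ∈ M_i} ω(k)) |c_i| ≤ Y`. -/
def Rep (ν : ℝ) (ω : ℤ → ℝ≥0∞) (𝒰 : (ℝ → ℂ) → Prop) (N : ℕ) (X Y : ℝ≥0∞)
    (F : ℝ → ℝ → ℂ) : Prop :=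
  ∃ (ι : Type) (_ : Countable ι) (c : ι → ℂ) (M : ι → Multiset ℤ) (u : ι → ℝ → ℂ),
    (∀ i, 𝒰 (u i)) ∧ (∀ i, (M i).card = N) ∧
    (∑' i, ewt ν (M i).sum * ‖c i‖ₑ ≤ X) ∧
    (∑' i, ewt ν (M i).sum * ((M i).map ω).sum * ‖c i‖ₑ ≤ Y) ∧
    ∀ α, ∀ β ∈ punct, HasSum (fun i => c i * osc (M i).sum α * u i β) (F α β)

/-- The class whose only member is the constant function `1`. -/
def IsOne (u : ℝ → ℂ) : Prop := u = fun _ => 1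

lemma IsOne.apply {u : ℝ → ℂ} (h : IsOne u) (β : ℝ) : u β = 1 := congrFun h β

/-- A sample point at which to evaluate expansions that do not depend on `β`. -/
lemma pi_mem_punct : π ∈ punct := ⟨Real.pi_ne_zero, (abs_of_pos Real.pi_pos).le⟩

lemma hasSum_of_eq {ι : Type} {f g : ι → ℂ} {a : ℂ} (e : ∀ i, g i = f i) (h : HasSum f a) :
    HasSum g a := (funext e : g = f) ▸ h

lemma summable_norm_of_tsum_ne_top {ι : Type} {c : ι → ℂ} (h : ∑' i, ‖c i‖ₑ ≠ ⊤) :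
    Summable fun i => ‖c i‖ := by
  have := ENNReal.tsum_coe_ne_top_iff_summable.1 h
  exact NNReal.summable_coe.2 this

lemma tsum_enorm_le {ν : ℝ} (hν : 0 ≤ ν) {ι : Type} {c : ι → ℂ} {K : ι → ℤ} {X : ℝ≥0∞}
    (h : ∑' i, ewt ν (K i) * ‖c i‖ₑ ≤ X) : ∑' i, ‖c i‖ₑ ≤ X :=
  (ENNReal.tsum_le_tsum fun i => le_mul_of_one_le_left' (one_le_ewt hν (K i))).trans h

lemma summable_norm_of_weight {ν : ℝ} (hν : 0 ≤ ν) {ι : Type} {c : ι → ℂ} {K : ι → ℤ} {X : ℝ≥0∞}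
    (h : ∑' i, ewt ν (K i) * ‖c i‖ₑ ≤ X) (hX : X ≠ ⊤) : Summable fun i => ‖c i‖ :=
  summable_norm_of_tsum_ne_top (ne_top_of_le_ne_top hX (tsum_enorm_le hν h))

variable {ν : ℝ} {ω : ℤ → ℝ≥0∞} {𝒰 𝒱 𝒲 : (ℝ → ℂ) → Prop} {N N' : ℕ} {X X' Y Y' : ℝ≥0∞}
  {F F' : ℝ → ℝ → ℂ}

/-! ### Algebra of expansions -/

lemma Rep.congr (h : Rep ν ω 𝒰 N X Y F) (e : ∀ α, ∀ β ∈ punct, F α β = F' α β) :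
    Rep ν ω 𝒰 N X Y F' := by
  obtain ⟨ι, hι, c, M, u, hu, hM, hX, hY, hs⟩ := h
  exact ⟨ι, hι, c, M, u, hu, hM, hX, hY, fun α β hβ => e α β hβ ▸ hs α β hβ⟩

lemma Rep.mono (h : Rep ν ω 𝒰 N X Y F) (hX : X ≤ X') (hY : Y ≤ Y') : Rep ν ω 𝒰 N X' Y' F := by
  obtain ⟨ι, hι, c, M, u, hu, hM, hX', hY', hs⟩ := h
  exact ⟨ι, hι, c, M, u, hu, hM, hX'.trans hX, hY'.trans hY, hs⟩

lemma rep_one (h : 𝒰 fun _ => 1) : Rep ν ω 𝒰 0 1 0 fun _ _ => 1 := by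
  refine ⟨Unit, inferInstance, fun _ => 1, fun _ => 0, fun _ _ => 1, fun _ => h, fun _ => rfl,
    ?_, ?_, fun α β _ => ?_⟩
  · simp [ewt]
  · simp
  · simp [osc_zero]

lemma Rep.smul (h : Rep ν ω 𝒰 N X Y F) (z : ℂ) :
    Rep ν ω 𝒰 N (‖z‖ₑ * X) (‖z‖ₑ * Y) fun α β => z * F α β := by
  obtain ⟨ι, hι, c, M, u, hu, hM, hX, hY, hs⟩ := h
  refine ⟨ι, hι, fun i => z * c i, M, u, hu, hM, ?_, ?_, fun α β hβ => ?_⟩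
  · simp_rw [enorm_mul, mul_left_comm _ ‖z‖ₑ, ENNReal.tsum_mul_left]
    gcongr
  · simp_rw [enorm_mul, mul_left_comm _ ‖z‖ₑ, ENNReal.tsum_mul_left]
    gcongr
  · simpa only [mul_assoc] using (hs α β hβ).mul_left z

/-- The weight `e^{ν|k|}` is submultiplicative, while the sum of `ω` over a multiset is additive;
hence the product rule for `X` and the Leibniz rule for `Y`. -/
lemma Rep.mul (hν : 0 ≤ ν) (hc : ∀ u v, 𝒰 u → 𝒱 v → 𝒲 fun β => u β * v β)
    (h : Rep ν ω 𝒰 N X Y F) (h' : Rep ν ω 𝒱 N' X' Y' F') :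
    Rep ν ω 𝒲 (N + N') (X * X') (Y * X' + X * Y') fun α β => F α β * F' α β := by
  obtain ⟨ι, hι, c, M, u, hu, hM, hX, hY, hs⟩ := h
  obtain ⟨κ, hκ, d, L, v, hv, hL, hX', hY', hs'⟩ := h'
  have prod : ∀ (a : ι → ℝ≥0∞) (b : κ → ℝ≥0∞), ∑' p : ι × κ, a p.1 * b p.2
      = (∑' i, a i) * ∑' j, b j := by
    intro a b
    rw [ENNReal.tsum_prod (f := fun i j => a i * b j)]
    simp_rw [ENNReal.tsum_mul_left, ENNReal.tsum_mul_right]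
  refine ⟨ι × κ, inferInstance, fun p => c p.1 * d p.2, fun p => M p.1 + L p.2,
    fun p β => u p.1 β * v p.2 β, fun p => hc _ _ (hu _) (hv _), fun p => by
      rw [Multiset.card_add, hM, hL], ?_, ?_, fun α β hβ => ?_⟩
  · calc _ ≤ ∑' p : ι × κ, (ewt ν (M p.1).sum * ‖c p.1‖ₑ) * (ewt ν (L p.2).sum * ‖d p.2‖ₑ) := by
          refine ENNReal.tsum_le_tsum fun p => ?_
          rw [Multiset.sum_add, enorm_mul, mul_mul_mul_comm]
          gcongr
          exact ewt_add_le hν _ _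
      _ = _ := prod (fun i => ewt ν (M i).sum * ‖c i‖ₑ) fun j => ewt ν (L j).sum * ‖d j‖ₑ
      _ ≤ _ := by gcongr
  · calc _ ≤ ∑' p : ι × κ, ((ewt ν (M p.1).sum * ((M p.1).map ω).sum * ‖c p.1‖ₑ)
            * (ewt ν (L p.2).sum * ‖d p.2‖ₑ) + (ewt ν (M p.1).sum * ‖c p.1‖ₑ)
            * (ewt ν (L p.2).sum * ((L p.2).map ω).sum * ‖d p.2‖ₑ)) := by
          refine ENNReal.tsum_le_tsum fun p => ?_
          rw [Multiset.sum_add, Multiset.map_add, Multiset.sum_add, enorm_mul]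
          calc _ ≤ (ewt ν (M p.1).sum * ewt ν (L p.2).sum) *
                (((M p.1).map ω).sum + ((L p.2).map ω).sum) * (‖c p.1‖ₑ * ‖d p.2‖ₑ) := by
                gcongr
                exact ewt_add_le hν _ _
            _ = _ := by ring
      _ = (∑' i, ewt ν (M i).sum * ((M i).map ω).sum * ‖c i‖ₑ) *
            (∑' j, ewt ν (L j).sum * ‖d j‖ₑ) + (∑' i, ewt ν (M i).sum * ‖c i‖ₑ) *
            (∑' j, ewt ν (L j).sum * ((L j).map ω).sum * ‖d j‖ₑ) := by
          rw [ENNReal.tsum_add, ← prod, ← prod]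
      _ ≤ _ := by gcongr
  · have h1 := hs α β hβ
    have h2 := hs' α β hβ
    have hsm := summable_mul_of_summable_norm h1.summable.norm h2.summable.norm
    refine hasSum_of_eq (fun p => ?_) (h1.mul h2 hsm)
    rw [Multiset.sum_add, osc_add]
    ring

lemma Rep.pow (hν : 0 ≤ ν) {𝒰 : ℕ → (ℝ → ℂ) → Prop} (h1 : 𝒰 0 fun _ => 1)
    (hc : ∀ n u v, 𝒰 n u → 𝒰 1 v → 𝒰 (n + 1) fun β => u β * v β)
    (h : Rep ν ω (𝒰 1) 1 X Y F) (n : ℕ) :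
    Rep ν ω (𝒰 n) n (X ^ n) (n * X ^ (n - 1) * Y) fun α β => F α β ^ n := by
  induction n with
  | zero => simpa using rep_one h1
  | succ n ih =>
    have h2 := ih.mul hν (hc n) h
    refine (h2.congr fun α β _ => (pow_succ (F α β) n).symm).mono (pow_succ X n).ge (le_of_eq ?_)
    rcases n with _ | n
    · simp
    · rw [Nat.add_sub_cancel, Nat.add_sub_cancel]
      push_cast
      ring

/-- Merges the `N` frequencies of each mode into one, at the cost `b N` in `Y` and nothing in `X`.
Expansions with different `N` become summable together only after this. -/
lemma Rep.collapse {b : ℕ → ℝ≥0∞}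
    (hb : ∀ M : Multiset ℤ, ω M.sum ≤ b M.card * (M.map ω).sum) (h : Rep ν ω 𝒰 N X Y F) :
    Rep ν ω 𝒰 1 X (b N * Y) F := by
  obtain ⟨ι, hι, c, M, u, hu, hM, hX, hY, hs⟩ := h
  refine ⟨ι, hι, c, fun i => {(M i).sum}, u, hu, fun i => by simp, by simpa using hX, ?_,
    by simpa using hs⟩
  calc _ ≤ ∑' i, b N * (ewt ν (M i).sum * ((M i).map ω).sum * ‖c i‖ₑ) := by
        refine ENNReal.tsum_le_tsum fun i => ?_
        simp only [Multiset.sum_singleton, Multiset.map_singleton]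
        calc _ ≤ ewt ν (M i).sum * (b N * ((M i).map ω).sum) * ‖c i‖ₑ := by
              gcongr
              rw [← hM i]; exact hb (M i)
          _ = _ := by ring
    _ ≤ _ := by rw [ENNReal.tsum_mul_left]; gcongr

lemma Rep.summable_of_bound (hν : 0 ≤ ν) {C : ℝ}
    {ι : Type} {c : ι → ℂ} {K : ι → ℤ} {u : ι → ℝ → ℂ} {β : ℝ}
    (hu : ∀ i, ‖u i β‖ ≤ C) (hX : ∑' i, ewt ν (K i) * ‖c i‖ₑ ≠ ⊤) (α : ℝ) :
    Summable fun i => c i * osc (K i) α * u i β := by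
  refine Summable.of_norm_bounded ((summable_norm_of_weight hν le_rfl hX).mul_right C)
    fun i => ?_
  rw [norm_mul, norm_mul, norm_osc, mul_one]
  gcongr
  exact hu i

/-- Only the sum of the `X m` must be finite; the second bound may be infinite throughout. -/
lemma Rep.tsum (hν : 0 ≤ ν) {κ : Type} [Countable κ] {C : ℝ}
    (hC : ∀ u, 𝒰 u → ∀ β ∈ punct, ‖u β‖ ≤ C) {X Y : κ → ℝ≥0∞} {F : κ → ℝ → ℝ → ℂ}
    (h : ∀ m, Rep ν ω 𝒰 N (X m) (Y m) (F m)) (hX : ∑' m, X m ≠ ⊤) :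
    Rep ν ω 𝒰 N (∑' m, X m) (∑' m, Y m) fun α β => ∑' m, F m α β := by
  choose ι hι c M u hu hM hX' hY' hs using h
  have h1 : ∑' p : Σ m, ι m, ewt ν (M p.1 p.2).sum * ‖c p.1 p.2‖ₑ ≤ ∑' m, X m := by
    rw [ENNReal.tsum_sigma']
    exact ENNReal.tsum_le_tsum fun m => hX' m
  refine ⟨Σ m, ι m, inferInstance, fun p => c p.1 p.2, fun p => M p.1 p.2, fun p => u p.1 p.2,
    fun p => hu _ _, fun p => hM _ _, h1, ?_, fun α β hβ => ?_⟩
  · rw [ENNReal.tsum_sigma']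
    exact ENNReal.tsum_le_tsum fun m => hY' m
  · have hsm := Rep.summable_of_bound hν (K := fun p : Σ m, ι m => (M p.1 p.2).sum)
      (u := fun p => u p.1 p.2) (β := β) (fun p => hC _ (hu p.1 p.2) β hβ)
      (ne_top_of_le_ne_top hX h1) α
    have h2 := hsm.hasSum
    have h3 := h2.sigma fun m => hs m α β hβ
    change HasSum _ (∑' m, F m α β)
    rw [h3.tsum_eq]
    exact h2

lemma Rep.add (hν : 0 ≤ ν) {C : ℝ} (hC : ∀ u, 𝒰 u → ∀ β ∈ punct, ‖u β‖ ≤ C)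
    (h : Rep ν ω 𝒰 N X Y F) (h' : Rep ν ω 𝒰 N X' Y' F') (hX : X ≠ ⊤) (hX' : X' ≠ ⊤) :
    Rep ν ω 𝒰 N (X + X') (Y + Y') fun α β => F α β + F' α β := by
  have h2 := Rep.tsum hν hC (X := fun b : Bool => bif b then X' else X)
    (Y := fun b => bif b then Y' else Y) (F := fun b => bif b then F' else F)
    (by rintro (_ | _) <;> assumption) (by rw [tsum_bool]; exact ENNReal.add_ne_top.2 ⟨hX, hX'⟩)
  simp only [tsum_bool] at h2
  exact h2

lemma Rep.norm_le (hν : 0 ≤ ν) {C : ℝ} (hC0 : 0 ≤ C)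
    (hC : ∀ u, 𝒰 u → ∀ β ∈ punct, ‖u β‖ ≤ C) (h : Rep ν ω 𝒰 N X Y F) (hX : X ≠ ⊤) (α : ℝ) {β : ℝ}
    (hβ : β ∈ punct) : ‖F α β‖ ≤ X.toReal * C := by
  obtain ⟨ι, hι, c, M, u, hu, hM, hX', hY, hs⟩ := h
  have hsum := summable_norm_of_weight hν hX' hX
  have h1 : ∑' i, ‖c i‖ ≤ X.toReal := by
    have h2 := ENNReal.toReal_mono hX (tsum_enorm_le hν hX')
    rw [ENNReal.tsum_toReal_eq (fun i => enorm_ne_top)] at h2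
    simpa using h2
  rw [← (hs α β hβ).tsum_eq]
  refine (tsum_of_norm_bounded ((hsum.mul_right C).hasSum) fun i => ?_).trans ?_
  · rw [norm_mul, norm_mul, norm_osc, mul_one]
    gcongr
    exact hC _ (hu i) β hβ
  · rw [tsum_mul_right]
    gcongr

lemma isOne_norm_le : ∀ u, IsOne u → ∀ β ∈ punct, ‖u β‖ ≤ 1 := by
  rintro u rfl β _
  simp

lemma IsOne.mul (u v : ℝ → ℂ) (hu : IsOne u) (hv : IsOne v) : IsOne fun β => u β * v β := by
  rw [IsOne] at *
  subst hu hv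
  simp

/-! ### Expansions of the functions in `𝓕^{0,1}_ν` -/

/-- The Fourier coefficients weighted by `e^{ν|k|}`, summed in `[0, ∞]`. -/
def enormF (ν : ℝ) (g : ℝ → ℂ) : ℝ≥0∞ := ∑' k : ℤ, ewt ν k * ‖fhat g k‖ₑ

/-- The Fourier coefficients weighted by `e^{ν|k|} ω(k)`, summed in `[0, ∞]`. -/
def enormFW (ν : ℝ) (ω : ℤ → ℝ≥0∞) (g : ℝ → ℂ) : ℝ≥0∞ := ∑' k : ℤ, ewt ν k * ω k * ‖fhat g k‖ₑ

lemma MemF.rep (hν : 0 ≤ ν) {g : ℝ → ℂ} (hg : MemF ν g) :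
    Rep ν ω IsOne 1 (enormF ν g) (enormFW ν ω g) fun α _ => g α := by
  refine ⟨ℤ, inferInstance, fhat g, fun k => {k}, fun _ _ => 1, fun _ => rfl, fun _ => by simp,
    by simp [enormF], by simp [enormFW], fun α β _ => ?_⟩
  simpa using hg.hasSum hν α

lemma MemF.rep_shift (hν : 0 ≤ ν) {g : ℝ → ℂ} (hg : MemF ν g) :
    Rep ν ω (Mode 0) 1 (enormF ν g) (enormFW ν ω g) fun α β => g (α - β) := by
  refine ⟨ℤ, inferInstance, fhat g, fun k => {k}, wave, mode_wave, fun _ => by simp,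
    by simp [enormF], by simp [enormFW], fun α β _ => ?_⟩
  simpa [osc_sub_right, mul_assoc] using hg.hasSum hν (α - β)

/-! ### Averaging and principal values of expansions -/

/-- The phase `e^{i(τ-1)β}` shifts the frequency `K` of each mode to `p = K + 1`, after which
`exists_mode_avg` applies. -/
lemma Rep.avg (hν : 0 ≤ ν) {h : ℝ → ℂ} (hr : Rep ν ω IsOne N X Y fun α _ => h α) (hX : X ≠ ⊤) :
    Rep ν ω (Mode 1) N X Y fun α β => quot β *
      ∫ τ in (0 : ℝ)..1, Complex.exp (Complex.I * (((τ - 1) * β : ℝ) : ℂ)) *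
        h (α + (τ - 1) * β) := by
  obtain ⟨ι, hι, c, M, u, hu, hM, hX', hY, hs⟩ := hr
  choose v hv hv' using exists_mode_avg
  refine ⟨ι, hι, c, M, fun i => v ((M i).sum + 1), fun i => hv _, hM, hX', hY, fun α β hβ => ?_⟩
  have hsum := summable_norm_of_weight hν hX' hX
  have hh : ∀ x, HasSum (fun i => c i * osc (M i).sum x) (h x) := by
    intro x
    simpa only [(hu _).apply, mul_one] using hs x π pi_mem_punct
  have key : HasSum (fun i => ∫ τ in (0 : ℝ)..1,
      Complex.exp (Complex.I * (((τ - 1) * β : ℝ) : ℂ)) *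
        (c i * osc (M i).sum (α + (τ - 1) * β)))
      (∫ τ in (0 : ℝ)..1, Complex.exp (Complex.I * (((τ - 1) * β : ℝ) : ℂ)) *
        h (α + (τ - 1) * β)) := by
    refine intervalIntegral.hasSum_integral_of_dominated_convergence (fun i _ => ‖c i‖) ?_ ?_ ?_ ?_ ?_
    · intro i
      have := continuous_osc (M i).sum
      exact Continuous.aestronglyMeasurable (by fun_prop)
    · refine fun i => ae_of_all _ fun τ _ => ?_
      rw [norm_mul, norm_mul, norm_osc, mul_one, mul_comm Complex.I, Complex.norm_exp_ofReal_mul_I,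
        one_mul]
    · exact ae_of_all _ fun τ _ => hsum
    · simp
    · exact ae_of_all _ fun τ _ => (hh _).mul_left _
  refine hasSum_of_eq (fun i => ?_) (key.mul_left (quot β))
  simp only []
  rw [← hv' _ β hβ, mul_left_comm, ← intervalIntegral.integral_const_mul]
  congr 1
  refine intervalIntegral.integral_congr fun τ _ => ?_
  have e : Complex.exp (Complex.I * ((((M i).sum + 1 : ℤ) : ℂ) * (((τ - 1) * β : ℝ) : ℂ)))
      = osc (M i).sum ((τ - 1) * β) * Complex.exp (Complex.I * (((τ - 1) * β : ℝ) : ℂ)) := by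
    rw [osc, ← Complex.exp_add]; congr 1; push_cast; ring
  rw [e, osc_add_right]
  ring

/-- Dominated convergence twice: for fixed `ε` the sum over modes leaves the integral, since `1/den`
is bounded there; then `ε → 0` passes inside the sum by the uniform bound on `modeInt`. Only the
limits, of size at most `π a_n`, enter the new coefficients. -/
lemma Rep.principalValue (hν : 0 ≤ ν) {n : ℕ} (hr : Rep ν ω (Mode n) N X Y F) (hX : X ≠ ⊤)
    {k : ℝ → ℝ → ℂ} (hk : ∀ α, ∀ β ∈ punct, k α β = F α β / den β) :
    (∀ α, PVExists (k α)) ∧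
    Rep ν ω IsOne N (ENNReal.ofReal (π * aCoef n) * X) (ENNReal.ofReal (π * aCoef n) * Y)
      fun α _ => pv (k α) := by
  have hbd := hr.norm_le hν (by positivity : 0 ≤ (π / 2) ^ n) (fun u hu β hβ => hu.norm_le hβ) hX
  obtain ⟨ι, hι, c, M, u, hu, hM, hX', hY, hs⟩ := hr
  have hsum := summable_norm_of_weight hν hX' hX
  have hpos := aCoef_pos n
  choose L hL ht using fun i => (hu i).tendsto_modeInt
  have hae : ∀ α ε, 0 < ε → ∀ᵐ β ∂(truncMeasure ε),
      HasSum (fun i => c i * osc (M i).sum α * (u i β / den β)) (k α β) := by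
    intro α ε h0
    filter_upwards [ae_truncMeasure h0] with β hβ
    rw [hk α β hβ.1]
    simpa only [mul_div_assoc] using (hs α β hβ.1).div_const (den β)
  have hint : ∀ α ε, 0 < ε → Integrable (k α) (truncMeasure ε) := by
    intro α ε h0
    refine Integrable.of_bound (C := X.toReal * (π / 2) ^ n / (2 / π * ε)) ?_ ?_
    -- Measurability of `k α` is not given; it is inherited from the series that represents it
    -- almost everywhere.
    · have : AEStronglyMeasurable
          (fun β => ∑' i, c i * osc (M i).sum α * (u i β / den β)) (truncMeasure ε) :=
        AEStronglyMeasurable.tsum fun i =>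
          (((hu i).measurable.div measurable_den).const_mul _).aestronglyMeasurable
      refine this.congr ?_
      filter_upwards [hae α ε h0] with β hβ using hβ.tsum_eq
    · filter_upwards [ae_truncMeasure h0] with β hβ
      rw [hk α β hβ.1]
      exact norm_div_den_le h0 (by positivity) (fun β h => hbd α h) hβ.1 hβ.2
  have htr : ∀ α ε, 0 < ε → ε < π →
      HasSum (fun i => c i * osc (M i).sum α * modeInt (u i) ε) (truncIntegral (k α) ε) := by
    intro α ε h0 h1
    rw [← integral_truncMeasure h1 (hint α ε h0)]
    simp only [modeInt, ← integral_const_mul]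
    refine hasSum_integral_of_dominated_convergence
      (fun i _ => ‖c i‖ * ((π / 2) ^ n / (2 / π * ε))) ?_ ?_ ?_ ?_ (hae α ε h0)
    · exact fun i => (((hu i).measurable.div measurable_den).const_mul _).aestronglyMeasurable
    · intro i
      filter_upwards [ae_truncMeasure h0] with β hβ
      rw [norm_mul, norm_mul, norm_osc, mul_one]
      gcongr
      exact norm_div_den_le h0 (by positivity) (fun _ => (hu i).norm_le) hβ.1 hβ.2
    · exact ae_of_all _ fun _ => hsum.mul_right _
    · simp
  have hlim : ∀ α, Tendsto (truncIntegral (k α)) (𝓝[>] 0)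
      (𝓝 (∑' i, c i * osc (M i).sum α * L i)) := by
    intro α
    have hm : Set.Ioo (0 : ℝ) π ∈ 𝓝[>] (0 : ℝ) := Ioo_mem_nhdsGT Real.pi_pos
    have : Tendsto (fun ε => ∑' i, c i * osc (M i).sum α * modeInt (u i) ε) (𝓝[>] 0)
        (𝓝 (∑' i, c i * osc (M i).sum α * L i)) := by
      refine tendsto_tsum_of_dominated_convergence (hsum.mul_right (3 * π + 2 + π * aCoef n))
        (fun i => (ht i).const_mul _) ?_
      filter_upwards [hm] with ε hε i
      rw [norm_mul, norm_mul, norm_osc, mul_one]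
      gcongr
      exact (hu i).norm_modeInt_le hε.1 hε.2
    refine this.congr' ?_
    filter_upwards [hm] with ε hε using (htr α ε hε.1 hε.2).tsum_eq
  have hLe : ∀ i, ‖L i‖ₑ ≤ ENNReal.ofReal (π * aCoef n) := fun i => by
    rw [← ofReal_norm]; exact ENNReal.ofReal_le_ofReal (hL i)
  refine ⟨fun α => ⟨fun ε h0 h1 => (integrable_truncMeasure_iff h1).1 (hint α ε h0), _, hlim α⟩,
    ι, hι, fun i => c i * L i, M, fun _ _ => 1, fun _ => rfl, hM, ?_, ?_, fun α β _ => ?_⟩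
  · calc _ ≤ ∑' i, ENNReal.ofReal (π * aCoef n) * (ewt ν (M i).sum * ‖c i‖ₑ) := by
          refine ENNReal.tsum_le_tsum fun i => ?_
          rw [enorm_mul, mul_comm ‖c i‖ₑ, mul_left_comm]
          gcongr
          exact hLe i
      _ ≤ _ := by rw [ENNReal.tsum_mul_left]; gcongr
  · calc _ ≤ ∑' i, ENNReal.ofReal (π * aCoef n) *
            (ewt ν (M i).sum * ((M i).map ω).sum * ‖c i‖ₑ) := by
          refine ENNReal.tsum_le_tsum fun i => ?_
          rw [enorm_mul, mul_comm ‖c i‖ₑ, mul_left_comm]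
          gcongr
          exact hLe i
      _ ≤ _ := by rw [ENNReal.tsum_mul_left]; gcongr
  · change HasSum _ (pv (k α))
    rw [show pv (k α) = ∑' i, c i * osc (M i).sum α * L i from (hlim α).limUnder_eq]
    have : Summable fun i => c i * osc (M i).sum α * L i := by
      refine Summable.of_norm_bounded (hsum.mul_right (π * aCoef n)) fun i => ?_
      rw [norm_mul, norm_mul, norm_osc, mul_one]
      gcongr
      exact hL i
    convert this.hasSum using 2 with i
    ring

/-! ### Norms of functions given by expansions -/

/-- The coefficient at `k` is the sum of the `c_i` with `K_i = k`. The triangle inequality and an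
exchange of sums finish the estimate for any weight. -/
lemma tsum_fhat_le (hν : 0 ≤ ν) {ι : Type} [Countable ι] {c : ι → ℂ} {K : ι → ℤ} {h : ℝ → ℂ}
    (hX : ∑' i, ewt ν (K i) * ‖c i‖ₑ ≠ ⊤)
    (hs : ∀ α, HasSum (fun i => c i * osc (K i) α) (h α)) (w : ℤ → ℝ≥0∞) :
    ∑' k, w k * ‖fhat h k‖ₑ ≤ ∑' i, w (K i) * ‖c i‖ₑ := by
  have hsum := summable_norm_of_weight hν le_rfl hX
  have hf : ∀ k, ‖fhat h k‖ₑ ≤ ∑' i, if K i = k then ‖c i‖ₑ else 0 := by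
    intro k
    have h1 : HasSum (fun i => ∫ x in (-π)..π, osc (-k) x * (c i * osc (K i) x))
        (∫ x in (-π)..π, osc (-k) x * h x) := by
      refine intervalIntegral.hasSum_integral_of_dominated_convergence (fun i _ => ‖c i‖)
        ?_ ?_ ?_ ?_ ?_
      · intro i
        have := continuous_osc (K i)
        have := continuous_osc (-k)
        exact Continuous.aestronglyMeasurable (by fun_prop)
      · refine fun i => ae_of_all _ fun x _ => ?_
        rw [norm_mul, norm_mul, norm_osc, norm_osc, mul_one, one_mul]
      · exact ae_of_all _ fun x _ => hsum
      · simp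
      · exact ae_of_all _ fun x _ => (hs x).mul_left _
    have h2 := h1.mul_left (1 / (2 * (π : ℂ)))
    rw [← fhat_eq] at h2
    have h3 : ∀ i, 1 / (2 * (π : ℂ)) * ∫ x in (-π)..π, osc (-k) x * (c i * osc (K i) x)
        = if K i = k then c i else 0 := by
      intro i
      have e : ∀ x, osc (-k) x * (c i * osc (K i) x) = c i * osc (-k + K i) x := by
        intro x; rw [osc_add]; ring
      simp_rw [e]
      rw [intervalIntegral.integral_const_mul, integral_osc]
      have hp : (π : ℂ) ≠ 0 := by exact_mod_cast Real.pi_ne_zero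
      by_cases hk : K i = k
      · rw [if_pos hk, if_pos (by omega)]; field_simp
      · rw [if_neg hk, if_neg (by omega)]; simp
    simp_rw [h3] at h2
    rw [← h2.tsum_eq]
    refine enorm_tsum_le_tsum_enorm.trans (le_of_eq (tsum_congr fun i => ?_))
    split_ifs <;> simp
  calc _ ≤ ∑' k, ∑' i, w k * (if K i = k then ‖c i‖ₑ else 0) := by
        refine ENNReal.tsum_le_tsum fun k => ?_
        rw [ENNReal.tsum_mul_left]
        gcongr
        exact hf k
    _ = ∑' i, ∑' k, w k * (if K i = k then ‖c i‖ₑ else 0) := ENNReal.tsum_comm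
    _ = _ := by
        refine tsum_congr fun i => ?_
        rw [tsum_eq_single (K i) fun k hk => by rw [if_neg (Ne.symm hk), mul_zero], if_pos rfl]

lemma Rep.memF (hν : 0 ≤ ν) {h : ℝ → ℂ} (hr : Rep ν ω IsOne 1 X Y fun α _ => h α) (hX : X ≠ ⊤) :
    Continuous h ∧ Function.Periodic h (2 * π) ∧ enormF ν h ≤ X ∧ enormFW ν ω h ≤ Y := by
  obtain ⟨ι, hι, c, M, u, hu, hM, hX', hY, hs⟩ := hr
  have hh : ∀ x, HasSum (fun i => c i * osc (M i).sum x) (h x) := by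
    intro x
    simpa only [(hu _).apply, mul_one] using hs x π pi_mem_punct
  have hsum := summable_norm_of_weight hν hX' hX
  have hX'' := ne_top_of_le_ne_top hX hX'
  refine ⟨?_, fun x => ?_, (tsum_fhat_le hν hX'' hh (ewt ν)).trans hX',
    (tsum_fhat_le hν hX'' hh fun k => ewt ν k * ω k).trans (le_trans (le_of_eq ?_) hY)⟩
  · rw [show h = fun x => ∑' i, c i * osc (M i).sum x from funext fun x => (hh x).tsum_eq.symm]
    refine continuous_tsum (fun i => (continuous_osc _).const_mul _) hsum fun i x => ?_
    rw [norm_mul, norm_osc, mul_one]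
  · have := hh (x + 2 * π)
    simp_rw [osc_periodic] at this
    exact this.unique (hh x)
  · refine tsum_congr fun i => ?_
    obtain ⟨k, hk⟩ := Multiset.card_eq_one.1 (hM i)
    simp [hk]

/-! ### From sums in `[0, ∞]` to real norms -/

lemma ewt_mul_enorm (g : ℝ → ℂ) (k : ℤ) :
    ewt ν k * ‖fhat g k‖ₑ = ENNReal.ofReal (normTerm ν g k) := by
  rw [ewt, normTerm, ENNReal.ofReal_mul (Real.exp_nonneg _), ofReal_norm]

lemma normTerm_nonneg (g : ℝ → ℂ) (k : ℤ) : 0 ≤ normTerm ν g k := by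
  unfold normTerm; positivity

lemma MemF.enormF_eq {g : ℝ → ℂ} (hg : MemF ν g) : enormF ν g = ENNReal.ofReal (normF ν g) := by
  unfold enormF normF
  simp_rw [ewt_mul_enorm]
  exact (ENNReal.ofReal_tsum_of_nonneg (normTerm_nonneg g) hg.summable).symm

lemma summable_of_tsum_ofReal_le {ι : Type} {a : ι → ℝ} (ha : ∀ i, 0 ≤ a i) {B : ℝ} (hB : 0 ≤ B)
    (h : ∑' i, ENNReal.ofReal (a i) ≤ ENNReal.ofReal B) : Summable a ∧ ∑' i, a i ≤ B := by
  have h1 : Summable a := by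
    have := ENNReal.summable_toReal (ne_top_of_le_ne_top ENNReal.ofReal_ne_top h)
    simpa [ENNReal.toReal_ofReal, ha] using this
  refine ⟨h1, ?_⟩
  rw [← ENNReal.ofReal_tsum_of_nonneg ha h1] at h
  exact (ENNReal.ofReal_le_ofReal_iff hB).1 h

/-- The weight `|k|^s`. -/
def powWt (s : ℝ) (k : ℤ) : ℝ≥0∞ := ENNReal.ofReal (|(k : ℝ)| ^ s)

lemma homNormTerm_nonneg {s : ℝ} (g : ℝ → ℂ) (k : {k : ℤ // k ≠ 0}) :
    0 ≤ homNormTerm ν s g k := by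
  unfold homNormTerm; positivity

/-- The frequency `0` drops out because `0^s = 0` for `s > 0`. -/
lemma enormFW_powWt {s : ℝ} (hs : 0 < s) (g : ℝ → ℂ) :
    enormFW ν (powWt s) g = ∑' k : {k : ℤ // k ≠ 0}, ENNReal.ofReal (homNormTerm ν s g k) := by
  unfold enormFW
  rw [← tsum_subtype_eq_of_support_subset (s := {k : ℤ | k ≠ 0})]
  · refine tsum_congr fun k => ?_
    rw [ewt, powWt, homNormTerm, ENNReal.ofReal_mul (by positivity),
      ENNReal.ofReal_mul (Real.exp_nonneg _), ofReal_norm]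
  · intro k hk h0
    apply hk
    simp [h0, powWt, Real.zero_rpow hs.ne']

lemma enormFW_eq {s : ℝ} (hs : 0 < s) {g : ℝ → ℂ} (hg : FiniteHomNormF ν s g) :
    enormFW ν (powWt s) g = ENNReal.ofReal (homNormF ν s g) := by
  rw [enormFW_powWt hs]
  exact (ENNReal.ofReal_tsum_of_nonneg (homNormTerm_nonneg g) hg).symm

end

section

/-! ### The coefficients `b(n, s)` -/

lemma bCoef_nonneg (n : ℕ) (s : ℝ) : 0 ≤ bCoef n s := by
  unfold bCoef; split_ifs <;> positivity

lemma bCoef_pos (n : ℕ) (s : ℝ) : 0 < bCoef (n + 1) s := by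
  unfold bCoef; split_ifs <;> positivity

lemma add_rpow_le_of_le_one {a b s : ℝ} (ha : 0 ≤ a) (hb : 0 ≤ b) (hs : 0 ≤ s) (h : s ≤ 1) :
    (a + b) ^ s ≤ a ^ s + b ^ s := by
  lift a to NNReal using ha
  lift b to NNReal using hb
  exact_mod_cast NNReal.rpow_add_le_add_rpow a b hs h

/-- Subadditivity of `t ↦ t^s` for `s ≤ 1`, and the power mean inequality for `s > 1`. -/
lemma abs_multiset_sum_rpow_le {s : ℝ} (hs : 0 < s) (M : Multiset ℤ) :
    |(M.sum : ℝ)| ^ s ≤ bCoef M.card s * (M.map fun k : ℤ => |(k : ℝ)| ^ s).sum := by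
  unfold bCoef
  split_ifs with h
  · rw [one_mul]
    induction M using Multiset.induction_on with
    | empty => simp [Real.zero_rpow hs.ne']
    | cons a M ih =>
      rw [Multiset.sum_cons, Multiset.map_cons, Multiset.sum_cons, Int.cast_add]
      calc _ ≤ (|(a : ℝ)| + |(M.sum : ℝ)|) ^ s := by
            gcongr
            exact abs_add_le (a : ℝ) (M.sum : ℝ)
        _ ≤ |(a : ℝ)| ^ s + |(M.sum : ℝ)| ^ s :=
            add_rpow_le_of_le_one (abs_nonneg _) (abs_nonneg _) hs.le h
        _ ≤ _ := by gcongr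
  · push Not at h
    induction M using Quotient.inductionOn with
    | h l =>
      simp only [Multiset.quot_mk_to_coe, Multiset.sum_coe, Multiset.coe_card, Multiset.map_coe]
      have h1 := Real.rpow_sum_le_const_mul_sum_rpow Finset.univ
        (fun i : Fin l.length => ((l[i] : ℤ) : ℝ)) h.le
      have e1 : (l.sum : ℤ) = ∑ i : Fin l.length, l[i] := (Fin.sum_univ_getElem l).symm
      have e2 : (l.map fun k : ℤ => |(k : ℝ)| ^ s).sum = ∑ i : Fin l.length, |((l[i] : ℤ) : ℝ)| ^ s :=
        (Fin.sum_univ_fun_getElem l fun k : ℤ => |(k : ℝ)| ^ s).symm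
      rw [e1, e2]
      rw [Finset.card_univ, Fintype.card_fin] at h1
      refine le_trans ?_ h1
      push_cast
      gcongr
      exact Finset.abs_sum_le_sum_abs _ _

lemma powWt_multiset_sum_le {s : ℝ} (hs : 0 < s) (M : Multiset ℤ) :
    powWt s M.sum ≤ ENNReal.ofReal (bCoef M.card s) * (M.map (powWt s)).sum := by
  have e : (M.map (powWt s)).sum = ENNReal.ofReal (M.map fun k : ℤ => |(k : ℝ)| ^ s).sum := by
    induction M using Multiset.induction_on with
    | empty => simp
    | cons a M ih =>
      rw [Multiset.map_cons, Multiset.sum_cons, Multiset.map_cons, Multiset.sum_cons, ih,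
        ENNReal.ofReal_add (by positivity) (Multiset.sum_nonneg ?_), powWt]
      intro y hy
      obtain ⟨k, _, rfl⟩ := Multiset.mem_map.1 hy
      positivity
  rw [e, powWt, ← ENNReal.ofReal_mul (bCoef_nonneg _ _)]
  exact ENNReal.ofReal_le_ofReal (abs_multiset_sum_rpow_le hs M)

/-- Polynomial growth of `b` costs nothing against a geometric series with room to spare. -/
lemma exists_bCoef_le (s : ℝ) {r : ℝ} (hr : 1 < r) :
    ∃ C > 0, ∀ n : ℕ, bCoef (n + 1) s ≤ C * r ^ (n + 1) := by
  obtain ⟨k, hk⟩ := exists_nat_ge (s - 1)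
  have h := (isLittleO_pow_const_const_pow_of_one_lt (R := ℝ) k hr).isBigO
  obtain ⟨C, hC, hb⟩ := Asymptotics.bound_of_isBigO_nat_atTop h
  refine ⟨C + 1, by positivity, fun n => ?_⟩
  have h1 : 1 ≤ r ^ (n + 1) := one_le_pow₀ hr.le
  have h2 := hb (x := n + 1) (by positivity)
  rw [Real.norm_of_nonneg (by positivity), Real.norm_of_nonneg (by positivity)] at h2
  unfold bCoef
  split_ifs with hs
  · nlinarith
  · have h3 : ((n + 1 : ℕ) : ℝ) ^ (s - 1) ≤ ((n + 1 : ℕ) : ℝ) ^ (k : ℝ) :=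
      Real.rpow_le_rpow_of_exponent_le (by norm_cast; omega) hk
    rw [Real.rpow_natCast] at h3
    nlinarith

/-- A factor `n` is absorbed by raising the exponent, which reduces convergence of the `C_4` series
to that of a `C_3` series with larger `s`. -/
lemma mul_bCoef_le (n : ℕ) (s : ℝ) :
    ((n + 1 : ℕ) : ℝ) * bCoef (n + 1) s ≤ bCoef (n + 1) (max s 1 + 1) := by
  have hp : (0 : ℝ) < ((n + 1 : ℕ) : ℝ) := by positivity
  have h2 : ¬ (max s 1 + 1 ≤ 1) := by
    have := le_max_right s 1
    linarith
  simp only [bCoef, if_neg h2, add_sub_cancel_right]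
  split_ifs with h
  · rw [max_eq_right h, Real.rpow_one, mul_one]
  · rw [max_eq_left (le_of_not_ge h)]
    conv_lhs => rw [← Real.rpow_one ((n + 1 : ℕ) : ℝ), ← Real.rpow_mul hp.le,
      ← Real.rpow_add hp]
    ring_nf
    exact le_rfl

/-! ### The exponential quotients -/

lemma mul_expQuot₁ (x : ℝ) : x * expQuot₁ x = Real.exp x - 1 := by
  unfold expQuot₁
  split_ifs with h
  · simp [h]
  · field_simp

lemma sq_mul_expQuot₂ (x : ℝ) : x ^ 2 * expQuot₂ x = Real.exp x - 1 - x := by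
  unfold expQuot₂
  split_ifs with h
  · simp [h]
  · field_simp

lemma one_le_expQuot₁ {x : ℝ} (hx : 0 ≤ x) : 1 ≤ expQuot₁ x := by
  unfold expQuot₁
  split_ifs with h
  · exact le_rfl
  · rw [le_div_iff₀ (lt_of_le_of_ne hx (Ne.symm h))]
    linarith [Real.add_one_le_exp x]

lemma expQuot₂_pos {x : ℝ} (hx : 0 ≤ x) : 0 < expQuot₂ x := by
  unfold expQuot₂
  split_ifs with h
  · norm_num
  · have := Real.add_one_lt_exp h
    have h2 : 0 < x := lt_of_le_of_ne hx (Ne.symm h)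
    exact div_pos (by linarith) (by positivity)

lemma CR_pos : 0 < CR := by
  unfold CR; linarith [Ctilde_nonneg]

lemma aCoef_one : aCoef 1 = CR := by simp [aCoef, CR]

/-! ### Convergence and positivity of the constants -/

variable {s x : ℝ}

lemma expQuot₁_nonneg (hx : 0 ≤ x) : 0 ≤ expQuot₁ x := zero_le_one.trans (one_le_expQuot₁ hx)

lemma C5Term_nonneg (hx : 0 ≤ x) (m : ℕ) : 0 ≤ C5Term s x m := by
  have := bCoef_nonneg (m + 1) s
  unfold C5Term; positivity

lemma C3breveTerm_nonneg (hx : 0 ≤ x) (m : ℕ) : 0 ≤ C3breveTerm s x m := by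
  have := bCoef_nonneg (m + 3) s
  unfold C3breveTerm; positivity

lemma C4breveTerm_nonneg (hx : 0 ≤ x) (m : ℕ) : 0 ≤ C4breveTerm s x m := by
  have := bCoef_nonneg (m + 3) s
  unfold C4breveTerm; positivity

lemma C3tildeTerm_nonneg (hx : 0 ≤ x) (p : Idx) : 0 ≤ C3tildeTerm s x p := by
  have := bCoef_nonneg (p.1.2 + p.1.1 + 1) s
  have := (aCoef_pos p.1.1).le
  have := expQuot₁_nonneg hx
  unfold C3tildeTerm; positivity

lemma C5tilde_nonneg (hx : 0 ≤ x) (n : ℕ) : 0 ≤ C5tilde s x n := by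
  have : 0 ≤ ∑' m, C5Term s x m := tsum_nonneg (C5Term_nonneg hx)
  have := expQuot₁_nonneg hx
  unfold C5tilde; positivity

lemma C4tildeTerm_nonneg (hx : 0 ≤ x) (p : Idx) : 0 ≤ C4tildeTerm s x p := by
  have := bCoef_nonneg (p.1.2 + p.1.1 + 1) s
  have := (aCoef_pos p.1.1).le
  have := expQuot₁_nonneg hx
  have := C5tilde_nonneg (s := s) hx p.1.1
  unfold C4tildeTerm; positivity

lemma summable_bCoef_mul (hx : 0 ≤ x) (j k : ℕ) :
    Summable fun m : ℕ => bCoef (m + j + 1) s / (Nat.factorial (m + k) : ℝ) * x ^ m := by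
  obtain ⟨C, hC, hb⟩ := exists_bCoef_le s one_lt_two
  refine Summable.of_nonneg_of_le (fun m => ?_) (fun m => ?_)
    ((Real.summable_pow_div_factorial (2 * x)).mul_left (C * 2 ^ (j + 1)))
  · have := bCoef_nonneg (m + j + 1) s
    positivity
  · have h1 : (Nat.factorial m : ℝ) ≤ Nat.factorial (m + k) := by
      exact_mod_cast Nat.factorial_le (Nat.le_add_right m k)
    have h2 : (0 : ℝ) < Nat.factorial m := by exact_mod_cast Nat.factorial_pos m
    calc _ ≤ C * 2 ^ (m + j + 1) / (Nat.factorial m : ℝ) * x ^ m := by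
          gcongr
          exact hb _
      _ = _ := by rw [mul_pow]; ring

lemma summable_C5Term (hx : 0 ≤ x) : Summable (C5Term s x) := summable_bCoef_mul hx 0 0

lemma summable_C3breveTerm (hx : 0 ≤ x) : Summable (C3breveTerm s x) := summable_bCoef_mul hx 2 2

lemma summable_C4breveTerm (hx : 0 ≤ x) : Summable (C4breveTerm s x) := summable_bCoef_mul hx 2 1

lemma summable_C3tildeTerm_of_pos (hx : 0 < x) (hsm : π / 2 * (Real.exp x - 1) < 1) :
    Summable (C3tildeTerm s x) := by
  set y := Real.exp x - 1 with hy
  have hy0 : 0 < y := by rw [hy]; linarith [Real.add_one_lt_exp hx.ne']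
  have hpi := Real.pi_pos
  set q := π / 2 * y with hq
  have hq0 : 0 < q := by positivity
  -- Chosen so that `r > 1` and still `r q < 1`.
  set r := 2 / (1 + q) with hr
  have hr1 : 1 < r := by rw [hr, lt_div_iff₀ (by positivity)]; linarith
  have hrq : r * q < 1 := by
    rw [hr, div_mul_eq_mul_div, div_lt_one (by positivity)]; linarith
  obtain ⟨C, hC, hb⟩ := exists_bCoef_le s hr1
  have hCt := Ctilde_nonneg
  have hrq' : ‖r * q‖ < 1 := by rw [Real.norm_of_nonneg (by positivity)]; exact hrq
  have s1 : Summable fun n : ℕ => (1 + Ctilde * n) * (r * q) ^ n := by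
    have h1 := (summable_geometric_of_lt_one (by positivity) hrq).add
      ((hasSum_coe_mul_geometric_of_norm_lt_one hrq').summable.mul_left Ctilde)
    exact h1.congr fun n => by ring
  have s2 : Summable fun l : ℕ => (r * x) ^ l / (Nat.factorial l : ℝ) :=
    Real.summable_pow_div_factorial _
  have s3 : Summable fun p : ℕ × ℕ =>
      ((1 + Ctilde * p.1) * (r * q) ^ p.1) * ((r * x) ^ p.2 / (Nat.factorial p.2 : ℝ)) :=
    s1.mul_of_nonneg s2 (fun n => by positivity) (fun l => by positivity)
  refine Summable.of_nonneg_of_le (C3tildeTerm_nonneg hx.le) (fun p => ?_)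
    ((s3.comp_injective Subtype.val_injective).mul_left (C * r / x ^ 2))
  obtain ⟨⟨n, l⟩, hp⟩ := p
  simp only [C3tildeTerm, Function.comp]
  simp only at hp
  have e1 : x ^ (n + l - 2) * expQuot₁ x ^ n = x ^ l * y ^ n / x ^ 2 := by
    rw [eq_div_iff (by positivity), hy, ← mul_expQuot₁, mul_pow, mul_right_comm, ← pow_add,
      Nat.sub_add_cancel hp, pow_add]
    ring
  have e2 : aCoef n ≤ (1 + Ctilde * n) * (π / 2) ^ n := by
    unfold aCoef
    have h1 : (π / 2) ^ (n - 1) ≤ (π / 2) ^ n := pow_le_pow_right₀ one_le_pi_div_two (by omega)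
    have h2 : 1 ≤ (π / 2) ^ n := one_le_pow₀ one_le_pi_div_two
    have h3 : Ctilde * n * (π / 2) ^ (n - 1) ≤ Ctilde * n * (π / 2) ^ n := by gcongr
    linarith
  have h1 := hb (l + n)
  have h2 := bCoef_nonneg (l + n + 1) s
  have h3 := (aCoef_pos n).le
  calc _ = bCoef (l + n + 1) s / (Nat.factorial l : ℝ) * aCoef n *
        (x ^ (n + l - 2) * expQuot₁ x ^ n) := by ring
    _ = bCoef (l + n + 1) s / (Nat.factorial l : ℝ) * aCoef n * (x ^ l * y ^ n / x ^ 2) := by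
        rw [e1]
    _ ≤ (C * r ^ (l + n + 1)) / (Nat.factorial l : ℝ) * ((1 + Ctilde * n) * (π / 2) ^ n) *
        (x ^ l * y ^ n / x ^ 2) := by gcongr
    _ = _ := by
        rw [hq, mul_pow, mul_pow, mul_pow]; ring

lemma summable_C3tildeTerm (hx : 0 ≤ x) (hsm : π / 2 * (Real.exp x - 1) < 1) :
    Summable (C3tildeTerm s x) := by
  rcases hx.eq_or_lt with h | h
  · subst h
    have hpi := Real.pi_pos
    -- The comparison above divides by `x²`. At `x = 0` the terms are dominated by those at `log(1 +
    -- 1/π)`, where `(π/2)(e^x - 1) = 1/2`.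
    have h1 : (0 : ℝ) < Real.log (1 + 1 / π) := Real.log_pos (by
      have : 0 < 1 / π := by positivity
      linarith)
    have h2 := summable_C3tildeTerm_of_pos (s := s) h1 (by
      rw [Real.exp_log (by positivity)]
      field_simp
      norm_num)
    refine Summable.of_nonneg_of_le (C3tildeTerm_nonneg le_rfl) (fun p => ?_) h2
    have h3 := bCoef_nonneg (p.1.2 + p.1.1 + 1) s
    have h4 := (aCoef_pos p.1.1).le
    have h5 : expQuot₁ 0 ≤ expQuot₁ (Real.log (1 + 1 / π)) := by
      rw [expQuot₁, if_pos rfl]; exact one_le_expQuot₁ h1.le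
    have h6 := expQuot₁_nonneg le_rfl
    unfold C3tildeTerm
    gcongr
  · exact summable_C3tildeTerm_of_pos h hsm

lemma summable_C4tildeTerm (hx : 0 ≤ x) (hsm : π / 2 * (Real.exp x - 1) < 1) :
    Summable (C4tildeTerm s x) := by
  have hS : 0 ≤ ∑' m, C5Term s x m := tsum_nonneg (C5Term_nonneg hx)
  have hE := one_le_expQuot₁ hx
  refine Summable.of_nonneg_of_le (C4tildeTerm_nonneg hx) (fun p => ?_)
    ((summable_C3tildeTerm (s := max s 1 + 1) hx hsm).mul_left (1 + ∑' m, C5Term s x m))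
  obtain ⟨⟨n, l⟩, hp⟩ := p
  simp only [C4tildeTerm, C3tildeTerm, C5tilde]
  generalize ∑' m, C5Term s x m = S at *
  have h1 := mul_bCoef_le (l + n) s
  have h2 := bCoef_nonneg (l + n + 1) s
  have h3 := (aCoef_pos n).le
  have h4 : expQuot₁ x ^ (n - 1) ≤ expQuot₁ x ^ n := pow_le_pow_right₀ hE (by omega)
  have h5 : 0 ≤ expQuot₁ x := by linarith
  have h6 : (l : ℝ) * expQuot₁ x ^ n + n * expQuot₁ x ^ (n - 1) * S
      ≤ ((l + n + 1 : ℕ) : ℝ) * ((1 + S) * expQuot₁ x ^ n) := by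
    have h7 : (n : ℝ) * expQuot₁ x ^ (n - 1) * S ≤ n * expQuot₁ x ^ n * S := by gcongr
    have h8 : 0 ≤ (n : ℝ) * expQuot₁ x ^ n + l * S * expQuot₁ x ^ n
      + (1 + S) * expQuot₁ x ^ n := by positivity
    push_cast
    linarith
  calc _ ≤ bCoef (l + n + 1) s / (Nat.factorial l : ℝ) * aCoef n * x ^ (n + l - 2) *
        (((l + n + 1 : ℕ) : ℝ) * ((1 + S) * expQuot₁ x ^ n)) := by gcongr
    _ = (1 + S) * ((((l + n + 1 : ℕ) : ℝ) * bCoef (l + n + 1) s) / (Nat.factorial l : ℝ) *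
        aCoef n * x ^ (n + l - 2) * expQuot₁ x ^ n) := by ring
    _ ≤ _ := by gcongr

lemma constSeriesConverge (hx : 0 ≤ x) (hsm : π / 2 * (Real.exp x - 1) < 1) :
    ConstSeriesConverge s x :=
  ⟨summable_C3tildeTerm hx hsm, summable_C4tildeTerm hx hsm, summable_C5Term hx,
    summable_C3breveTerm hx, summable_C4breveTerm hx⟩

/-- The pair `(n, l) = (0, 2)`. -/
def idxZeroTwo : Idx := ⟨(0, 2), le_rfl⟩

lemma C3_pos (hx : 0 ≤ x) (hsm : π / 2 * (Real.exp x - 1) < 1) : 0 < C3 s x := by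
  have h1 : 0 < ∑' p : Idx, C3tildeTerm s x p := by
    refine (summable_C3tildeTerm hx hsm).tsum_pos (C3tildeTerm_nonneg hx) idxZeroTwo ?_
    have := bCoef_pos 2 s
    have := aCoef_pos 0
    simp only [C3tildeTerm, idxZeroTwo, zero_add, tsub_self, pow_zero, mul_one]
    positivity
  have := CR_pos
  have : 0 ≤ ∑' m, C3breveTerm s x m := tsum_nonneg (C3breveTerm_nonneg hx)
  unfold C3
  positivity

lemma C4_pos (hx : 0 ≤ x) (hsm : π / 2 * (Real.exp x - 1) < 1) : 0 < C4 s x := by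
  have h1 : 0 < ∑' p : Idx, C4tildeTerm s x p := by
    refine (summable_C4tildeTerm hx hsm).tsum_pos (C4tildeTerm_nonneg hx) idxZeroTwo ?_
    have := bCoef_pos 2 s
    have := aCoef_pos 0
    simp only [C4tildeTerm, C5tilde, idxZeroTwo, zero_add, tsub_self, pow_zero, mul_one,
      Nat.cast_zero, zero_mul, add_zero]
    positivity
  have := CR_pos
  have : 0 ≤ ∑' m, C4breveTerm s x m := tsum_nonneg (C4breveTerm_nonneg hx)
  unfold C4
  positivity

lemma exp_sub_one_lt (hsm : π / 2 * (Real.exp x - 1) < 1) : Real.exp x - 1 < 1 := by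
  by_contra h
  push Not at h
  nlinarith [one_le_pi_div_two]

lemma C1_pos (hx : 0 ≤ x) (hsm : π / 2 * (Real.exp x - 1) < 1) : 0 < C1 x := by
  have h1 := expQuot₂_pos hx
  have h2 := CR_pos
  have h3 := Ctilde_nonneg
  have h4 := exp_sub_one_lt hsm
  have h5 : 0 < 2 - Real.exp x := by linarith
  have h6 : 0 ≤ 2 - π / 2 * (Real.exp x - 1) := by linarith
  unfold C1 C1tilde
  positivity

/-- The term of index `(n, l)` of the series that bounds `S`. -/
def C1Term (x : ℝ) (p : ℕ × ℕ) : ℝ :=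
  x ^ p.2 / (Nat.factorial p.2 : ℝ) * aCoef p.1 * (Real.exp x - 1) ^ p.1

lemma C1Term_nonneg (hx : 0 ≤ x) (p : ℕ × ℕ) : 0 ≤ C1Term x p := by
  have := (aCoef_pos p.1).le
  have : 0 ≤ Real.exp x - 1 := by linarith [Real.add_one_le_exp x]
  unfold C1Term; positivity

/-- Over all pairs the double series is a product of an exponential series and a geometric plus an
arithmetic-geometric series. Removing three terms leaves exactly `C_1 x²` less the share of the tail
integral. -/
lemma hasSum_C1Term (hx : 0 ≤ x) (hsm : π / 2 * (Real.exp x - 1) < 1) :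
    HasSum (fun p : Idx => C1Term x p.1)
      (C1 x * x ^ 2 - CR * (Real.exp x - 1 - x)) := by
  set y := Real.exp x - 1 with hy
  have hy0 : 0 ≤ y := by rw [hy]; linarith [Real.add_one_le_exp x]
  have hy1 : y < 1 := exp_sub_one_lt hsm
  have hq : ‖π / 2 * y‖ < 1 := by rw [Real.norm_of_nonneg (by positivity)]; exact hsm
  have s1 : HasSum (fun n : ℕ => aCoef n * y ^ n)
      ((1 - y)⁻¹ + Ctilde * (2 / π) * (π / 2 * y / (1 - π / 2 * y) ^ 2)) := by
    have h := (hasSum_geometric_of_lt_one hy0 hy1).add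
      ((hasSum_coe_mul_geometric_of_norm_lt_one hq).mul_left (Ctilde * (2 / π)))
    refine (funext fun n => ?_ : (fun n : ℕ => aCoef n * y ^ n) = _) ▸ h
    rcases n with _ | n
    · simp [aCoef]
    · have hpi := Real.pi_ne_zero
      simp only [aCoef, Nat.add_sub_cancel, mul_pow, pow_succ]
      field_simp
  have s2 : HasSum (fun l : ℕ => x ^ l / (Nat.factorial l : ℝ)) (Real.exp x) := by
    rw [Real.exp_eq_exp_ℝ]
    exact NormedSpace.expSeries_div_hasSum_exp x
  have s3 := s1.mul s2 (s1.summable.mul_of_nonneg s2.summable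
    (fun n => by have := (aCoef_pos n).le; positivity) (fun l => by positivity))
  have s4 : HasSum (C1Term x) (((1 - y)⁻¹ + Ctilde * (2 / π) * (π / 2 * y / (1 - π / 2 * y) ^ 2))
      * Real.exp x) := by
    refine (funext fun p => ?_ : C1Term x = _) ▸ s3
    simp only [C1Term]; ring
  -- The pairs with `n + l < 2`.
  set T : Finset (ℕ × ℕ) := {(0, 0), (0, 1), (1, 0)} with hT
  have s5 : HasSum (fun p : {p // p ∉ T} => C1Term x p.1)
      (C1 x * x ^ 2 - CR * (Real.exp x - 1 - x)) := by
    rw [T.hasSum_compl_iff]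
    have e : ∑ p ∈ T, C1Term x p = 1 + x + CR * y := by
      rw [hT, Finset.sum_insert (by decide), Finset.sum_insert (by decide), Finset.sum_singleton]
      simp only [C1Term, aCoef_one]
      simp [aCoef]
      rw [hy]; ring
    have hx1 := mul_expQuot₁ x
    have hx2 := sq_mul_expQuot₂ x
    have hex : Real.exp x = 1 + y := by rw [hy]; ring
    have hd1 : 1 - y ≠ 0 := by linarith
    have hd2 : 1 - π / 2 * y ≠ 0 := by linarith
    have hd3 : 2 - Real.exp x = 1 - y := by rw [hex]; ring
    have hE : expQuot₁ x ^ 2 * x ^ 2 = y ^ 2 := by rw [← mul_pow, mul_comm, hx1]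
    have hC : C1 x * x ^ 2 = π * Ctilde / 2 * (Real.exp x * (expQuot₁ x ^ 2 * x ^ 2)) *
        ((2 - π / 2 * y) / (1 - π / 2 * y) ^ 2) + x ^ 2 * expQuot₂ x +
        (1 + Ctilde) * (expQuot₁ x ^ 2 * x ^ 2) +
        Real.exp x * (expQuot₁ x ^ 2 * x ^ 2) / (2 - Real.exp x) + CR * (x ^ 2 * expQuot₂ x) := by
      rw [C1, C1tilde]; ring
    have hpi := Real.pi_ne_zero
    have hd4 : 2 - π * y ≠ 0 := by intro h; apply hd2; linarith
    have hval : C1 x * x ^ 2 - CR * (Real.exp x - 1 - x) + ∑ p ∈ T, C1Term x p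
        = ((1 - y)⁻¹ + Ctilde * (2 / π) * (π / 2 * y / (1 - π / 2 * y) ^ 2)) * Real.exp x := by
      rw [e, hC, hE, hx2, hd3, hex, CR]
      field_simp
      ring
    rw [hval]
    exact s4
  have hiff : ∀ p : ℕ × ℕ, 2 ≤ p.1 + p.2 ↔ p ∉ T := by
    rintro ⟨n, l⟩
    simp only [hT, Finset.mem_insert, Finset.mem_singleton, Prod.mk.injEq]
    omega
  exact (Equiv.subtypeEquivRight hiff).hasSum_iff.2 s5

end

section

/-! ### Expansion of the operator -/

lemma normF_nonneg (ν : ℝ) (g : ℝ → ℂ) : 0 ≤ normF ν g := tsum_nonneg (normTerm_nonneg g)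

lemma homNormF_nonneg (ν s : ℝ) (g : ℝ → ℂ) : 0 ≤ homNormF ν s g :=
  tsum_nonneg (homNormTerm_nonneg g)

lemma enorm_I_pow_div (m k : ℕ) :
    ‖Complex.I ^ m / (Nat.factorial k : ℂ)‖ₑ = ENNReal.ofReal (1 / (Nat.factorial k : ℝ)) := by
  rw [← ofReal_norm, norm_div, norm_pow, Complex.norm_I, one_pow, Complex.norm_natCast]

lemma Mode.mul_zero_left {n : ℕ} (u v : ℝ → ℂ) (hu : Mode 0 u) (hv : Mode n v) :
    Mode n fun β => u β * v β := by
  simpa using hu.mul hv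

lemma hasSum_exp_tail_one (x : ℝ) :
    HasSum (fun m : ℕ => x ^ (m + 1) / (Nat.factorial (m + 1) : ℝ)) (Real.exp x - 1) := by
  have h : HasSum (fun m : ℕ => x ^ m / (Nat.factorial m : ℝ)) (Real.exp x) := by
    rw [Real.exp_eq_exp_ℝ]
    exact NormedSpace.expSeries_div_hasSum_exp x
  simpa using (hasSum_nat_add_iff' 1).2 h

lemma hasSum_exp_tail_two (x : ℝ) :
    HasSum (fun m : ℕ => x ^ (m + 2) / (Nat.factorial (m + 2) : ℝ)) (Real.exp x - 1 - x) := by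
  have h : HasSum (fun m : ℕ => x ^ m / (Nat.factorial m : ℝ)) (Real.exp x) := by
    rw [Real.exp_eq_exp_ℝ]
    exact NormedSpace.expSeries_div_hasSum_exp x
  simpa [Finset.sum_range_succ, sub_sub] using (hasSum_nat_add_iff' 2).2 h

lemma tsum_ofReal_eq {ι : Type} {a : ι → ℝ} (ha : ∀ i, 0 ≤ a i) {b : ℝ} (h : HasSum a b) :
    ∑' i, ENNReal.ofReal (a i) = ENNReal.ofReal b := by
  rw [← ENNReal.ofReal_tsum_of_nonneg ha h.summable, h.tsum_eq]

variable {ν s : ℝ} {f θ : ℝ → ℂ}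

lemma rep_taylorTerm (hν : 0 ≤ ν) (hθ : MemF ν θ) (ω : ℤ → ℝ≥0∞) (m : ℕ) :
    Rep ν ω (Mode 1) m (ENNReal.ofReal (normF ν θ ^ m / (Nat.factorial m : ℝ)))
      (ENNReal.ofReal (m * normF ν θ ^ (m - 1) / (Nat.factorial m : ℝ)) * enormFW ν ω θ)
      fun α β => quot β * taylorTerm θ α β m := by
  have hx := normF_nonneg ν θ
  have h1 := hθ.rep (ω := ω) hν
  rw [hθ.enormF_eq] at h1
  have h2 := h1.pow hν (𝒰 := fun _ => IsOne) rfl (fun _ => IsOne.mul) m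
  have h3 := (h2.avg hν (h := fun x => θ x ^ m) (ENNReal.pow_ne_top ENNReal.ofReal_ne_top)).smul
    (Complex.I ^ m / (Nat.factorial m : ℂ))
  refine (h3.congr fun α β _ => ?_).mono (le_of_eq ?_) (le_of_eq ?_)
  · simp only [taylorTerm]; ring
  · rw [enorm_I_pow_div, ← ENNReal.ofReal_pow hx, ← ENNReal.ofReal_mul (by positivity)]
    congr 1; ring
  · rw [enorm_I_pow_div, ← ENNReal.ofReal_pow hx, ← ENNReal.ofReal_natCast, ← mul_assoc,
      ← ENNReal.ofReal_mul (by positivity), ← ENNReal.ofReal_mul (by positivity)]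
    congr 2; ring

lemma Mode.norm_le_one {u : ℝ → ℂ} (hu : Mode 1 u) (β : ℝ) (hβ : β ∈ punct) : ‖u β‖ ≤ π / 2 := by
  simpa using hu.norm_le hβ

/-- Collapsing each term before summation produces the inner factors `b(m, s)` of `C_4`, since
`b(m,s) · m x^{m-1}/m! = b(m,s) x^{m-1}/(m-1)!`. -/
lemma rep_taylorSum₁ (hν : 0 ≤ ν) (hθ : MemF ν θ) (hs : 0 < s) :
    Rep ν (powWt s) (Mode 1) 1 (ENNReal.ofReal (Real.exp (normF ν θ) - 1))
      (ENNReal.ofReal (∑' m, C5Term s (normF ν θ) m) * enormFW ν (powWt s) θ)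
      fun α β => quot β * taylorSum₁ θ α β := by
  have hx := normF_nonneg ν θ
  have h1 := fun m => (rep_taylorTerm hν hθ (powWt s) (m + 1)).collapse
    (b := fun n => ENNReal.ofReal (bCoef n s)) (powWt_multiset_sum_le hs)
  have e1 := tsum_ofReal_eq (fun m => by positivity) (hasSum_exp_tail_one (normF ν θ))
  have h2 := Rep.tsum hν (fun u hu β hβ => hu.norm_le_one β hβ) h1
    (by rw [e1]; exact ENNReal.ofReal_ne_top)
  refine (h2.congr fun α β _ => ?_).mono e1.le (le_of_eq ?_)
  · rw [tsum_mul_left]; rfl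
  · rw [ENNReal.ofReal_tsum_of_nonneg (C5Term_nonneg hx) (summable_C5Term hx),
      ← ENNReal.tsum_mul_right]
    refine tsum_congr fun m => ?_
    rw [← mul_assoc, ← ENNReal.ofReal_mul (bCoef_nonneg _ _)]
    congr 2
    rw [C5Term, Nat.add_sub_cancel, Nat.factorial_succ]
    have : (Nat.factorial m : ℝ) ≠ 0 := by exact_mod_cast Nat.factorial_ne_zero m
    push_cast
    field_simp

lemma kernelN_eq (n : ℕ) (α : ℝ) {β : ℝ} (hβ : β ∈ punct) :
    kernelN f θ n α β = f (α - β) * (quot β * taylorSum₁ θ α β) ^ n / den β := by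
  have hd := den_ne_zero hβ
  have hb : (β : ℂ) ≠ 0 := by exact_mod_cast hβ.1
  have e : 1 - Complex.exp (-(Complex.I * (β : ℂ))) = den β := rfl
  rw [kernelN, e, quot, mul_pow, div_pow]
  field_simp
  ring

lemma kernelTail_eq (α : ℝ) {β : ℝ} (hβ : β ∈ punct) :
    kernelTail f θ α β = f (α - β) * (quot β * taylorSum₂ θ α β) / den β := by
  have hd := den_ne_zero hβ
  have hb : (β : ℂ) ≠ 0 := by exact_mod_cast hβ.1
  have e : 1 - Complex.exp (-(Complex.I * (β : ℂ))) = den β := rfl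
  rw [kernelTail, e, quot]
  field_simp

lemma rep_kernelN (hν : 0 ≤ ν) (hf : MemF ν f) (hθ : MemF ν θ) (hs : 0 < s) (n : ℕ) :
    (∀ α, PVExists (kernelN f θ n α)) ∧
    Rep ν (powWt s) IsOne (1 + n)
      (ENNReal.ofReal (π * aCoef n * (normF ν f * (Real.exp (normF ν θ) - 1) ^ n)))
      (ENNReal.ofReal (π * aCoef n * (Real.exp (normF ν θ) - 1) ^ n) * enormFW ν (powWt s) f +
        ENNReal.ofReal (π * aCoef n * (normF ν f * (n * (Real.exp (normF ν θ) - 1) ^ (n - 1) *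
          ∑' m, C5Term s (normF ν θ) m))) * enormFW ν (powWt s) θ)
      fun α _ => pv (kernelN f θ n α) := by
  have hx := normF_nonneg ν θ
  have hf0 := normF_nonneg ν f
  have hS : 0 ≤ ∑' m, C5Term s (normF ν θ) m := tsum_nonneg (C5Term_nonneg hx)
  have hy : 0 ≤ Real.exp (normF ν θ) - 1 := by linarith [Real.add_one_le_exp (normF ν θ)]
  have ha := (aCoef_pos n).le
  have hpi := Real.pi_pos.le
  have h1 := (rep_taylorSum₁ hν hθ hs).pow hν mode_one (fun n u v hu hv => hu.mul hv) n
  have h2 := hf.rep_shift (ω := powWt s) hν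
  rw [hf.enormF_eq] at h2
  have h3 := (h2.mul hν Mode.mul_zero_left h1).principalValue hν (ENNReal.mul_ne_top
    ENNReal.ofReal_ne_top (ENNReal.pow_ne_top ENNReal.ofReal_ne_top))
    (k := kernelN f θ n) fun α β hβ => kernelN_eq n α hβ
  refine ⟨h3.1, h3.2.mono (le_of_eq ?_) (le_of_eq ?_)⟩
  · rw [← ENNReal.ofReal_pow hy, ← ENNReal.ofReal_mul (by positivity),
      ← ENNReal.ofReal_mul (by positivity)]
  · generalize enormFW ν (powWt s) f = Tf
    generalize enormFW ν (powWt s) θ = Tθ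
    generalize ∑' m, C5Term s (normF ν θ) m = S at *
    generalize Real.exp (normF ν θ) - 1 = y at *
    rw [ENNReal.ofReal_mul (p := π * aCoef n) (by positivity),
      ENNReal.ofReal_mul (p := π * aCoef n) (by positivity), ENNReal.ofReal_mul hf0,
      ENNReal.ofReal_mul (q := S) (by positivity),
      ENNReal.ofReal_mul (p := (n : ℝ)) (by positivity), ENNReal.ofReal_pow hy,
      ENNReal.ofReal_pow hy, ENNReal.ofReal_natCast]
    ring

/-- There are `l` frequencies from `θ^l`, one from `f` and one from each of the `n` collapsed Taylor
sums, which explains `b(l+n+1, s)`. The factor `1/π` cancels the `π` in `π a_n`. -/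
lemma rep_sTerm (hν : 0 ≤ ν) (hf : MemF ν f) (hθ : MemF ν θ) (hs : 0 < s) (p : Idx) :
    Rep ν (powWt s) IsOne 1
      (ENNReal.ofReal (C1Term (normF ν θ) p.1 * normF ν f))
      (ENNReal.ofReal (C3tildeTerm s (normF ν θ) p * normF ν θ ^ 2) * enormFW ν (powWt s) f +
        ENNReal.ofReal (C4tildeTerm s (normF ν θ) p * normF ν θ * normF ν f) *
          enormFW ν (powWt s) θ)
      fun α _ => 1 / (π : ℂ) * sTerm θ f α p := by
  obtain ⟨⟨n, l⟩, hp⟩ := p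
  simp only at hp
  have hx := normF_nonneg ν θ
  have hf0 := normF_nonneg ν f
  have hS : 0 ≤ ∑' m, C5Term s (normF ν θ) m := tsum_nonneg (C5Term_nonneg hx)
  have hxE := mul_expQuot₁ (normF ν θ)
  have hE := expQuot₁_nonneg hx
  have ha := (aCoef_pos n).le
  have hpi := Real.pi_pos
  have hb := bCoef_nonneg (l + n + 1) s
  have h1 := hθ.rep (ω := powWt s) hν
  rw [hθ.enormF_eq] at h1
  have h2 := h1.pow hν (𝒰 := fun _ => IsOne) rfl (fun _ => IsOne.mul) l
  have h3 := (((h2.mul hν IsOne.mul (rep_kernelN hν hf hθ hs n).2).smul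
    (1 / (π : ℂ) * ((-1) ^ n * Complex.I ^ (l + n + 1) / (Nat.factorial l : ℂ)))).collapse
    (b := fun n => ENNReal.ofReal (bCoef n s)) (powWt_multiset_sum_le hs))
  have hz : ‖1 / (π : ℂ) * ((-1) ^ n * Complex.I ^ (l + n + 1) / (Nat.factorial l : ℂ))‖ₑ
      = ENNReal.ofReal (1 / π * (1 / (Nat.factorial l : ℝ))) := by
    rw [← ofReal_norm, norm_mul, norm_div, norm_div, norm_mul, norm_pow, norm_pow, Complex.norm_I,
      norm_neg, norm_one, Complex.norm_natCast, Complex.norm_real, Real.norm_of_nonneg hpi.le]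
    simp
  rw [hz, show l + (1 + n) = l + n + 1 by ring] at h3
  refine (h3.congr fun α β _ => ?_).mono (le_of_eq ?_) (le_of_eq ?_)
  · simp only [sTerm]; ring
  · have hy : 0 ≤ Real.exp (normF ν θ) - 1 := by linarith [Real.add_one_le_exp (normF ν θ)]
    rw [← ENNReal.ofReal_pow hx, ← ENNReal.ofReal_mul (by positivity),
      ← ENNReal.ofReal_mul (by positivity), C1Term]
    congr 1
    field_simp
  · rw [← hxE]
    simp only [C3tildeTerm, C4tildeTerm, C5tilde]
    generalize enormFW ν (powWt s) f = Tf
    generalize enormFW ν (powWt s) θ = Tθ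
    generalize ∑' m, C5Term s (normF ν θ) m = S at *
    generalize expQuot₁ (normF ν θ) = E at *
    generalize normF ν θ = x at *
    generalize normF ν f = f0 at *
    generalize bCoef (l + n + 1) s = b at *
    generalize aCoef n = a at *
    have hfac : (0 : ℝ) < Nat.factorial l := by exact_mod_cast Nat.factorial_pos l
    generalize (Nat.factorial l : ℝ) = L at *
    have expand : ENNReal.ofReal b * (ENNReal.ofReal (1 / π * (1 / L)) *
        ((l : ℝ≥0∞) * ENNReal.ofReal x ^ (l - 1) * Tθ *
          ENNReal.ofReal (π * a * (f0 * (x * E) ^ n)) +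
        ENNReal.ofReal x ^ l * (ENNReal.ofReal (π * a * (x * E) ^ n) * Tf +
          ENNReal.ofReal (π * a * (f0 * (n * (x * E) ^ (n - 1) * S))) * Tθ)))
      = (ENNReal.ofReal b * ENNReal.ofReal (1 / π * (1 / L)) * ENNReal.ofReal x ^ l *
          ENNReal.ofReal (π * a * (x * E) ^ n)) * Tf +
        (ENNReal.ofReal b * ENNReal.ofReal (1 / π * (1 / L)) * (l : ℝ≥0∞) *
          ENNReal.ofReal x ^ (l - 1) * ENNReal.ofReal (π * a * (f0 * (x * E) ^ n)) +
         ENNReal.ofReal b * ENNReal.ofReal (1 / π * (1 / L)) * ENNReal.ofReal x ^ l *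
          ENNReal.ofReal (π * a * (f0 * (n * (x * E) ^ (n - 1) * S)))) * Tθ := by ring
    rw [expand]
    simp only [← ENNReal.ofReal_pow hx, ← ENNReal.ofReal_natCast]
    rw [← ENNReal.ofReal_mul (by positivity), ← ENNReal.ofReal_mul (by positivity),
      ← ENNReal.ofReal_mul (by positivity), ← ENNReal.ofReal_mul (by positivity),
      ← ENNReal.ofReal_mul (by positivity), ← ENNReal.ofReal_mul (by positivity),
      ← ENNReal.ofReal_mul (by positivity), ← ENNReal.ofReal_add (by positivity) (by positivity)]
    congr 3
    · rw [mul_right_comm _ (E ^ n), mul_assoc _ (x ^ (n + l - 2)), ← pow_add,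
        Nat.sub_add_cancel hp, mul_pow, pow_add]
      field_simp
    -- For `l = 0` the factor `l` kills the truncated exponent `l - 1`; likewise for `n` below.
    · have e1 : (l : ℝ) * x ^ (l - 1) * x ^ n = l * (x ^ (n + l - 2) * x) := by
        rcases l with _ | k
        · simp
        · rw [mul_assoc, ← pow_succ, ← pow_add]
          congr 2
          omega
      have e2 : (n : ℝ) * x ^ (n - 1) * x ^ l = n * (x ^ (n + l - 2) * x) := by
        rcases n with _ | k
        · simp
        · rw [mul_assoc, ← pow_succ, ← pow_add]
          congr 2
          omega
      rw [mul_pow, mul_pow]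
      calc _ = b / L * a * f0 * (((l : ℝ) * x ^ (l - 1) * x ^ n) * E ^ n +
            ((n : ℝ) * x ^ (n - 1) * x ^ l) * (E ^ (n - 1) * S)) := by
            field_simp
        _ = _ := by rw [e1, e2]; ring

/-- Here the Taylor terms stay uncollapsed until multiplied by `f`, so a single `b(m+3, s)` appears.
One power of `quot` is present, hence the constant `a_1 = C_R`. -/
lemma rep_kernelTail (hν : 0 ≤ ν) (hf : MemF ν f) (hθ : MemF ν θ) (hs : 0 < s) :
    (∀ α, PVExists (kernelTail f θ α)) ∧
    Rep ν (powWt s) IsOne 1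
      (ENNReal.ofReal (CR * (Real.exp (normF ν θ) - 1 - normF ν θ) * normF ν f))
      (ENNReal.ofReal (CR * (∑' m, C3breveTerm s (normF ν θ) m) * normF ν θ ^ 2) *
          enormFW ν (powWt s) f +
        ENNReal.ofReal (CR * (∑' m, C4breveTerm s (normF ν θ) m) * normF ν θ * normF ν f) *
          enormFW ν (powWt s) θ)
      fun α _ => 1 / (π : ℂ) * pv (kernelTail f θ α) := by
  have hx := normF_nonneg ν θ
  have hf0 := normF_nonneg ν f
  have hpi := Real.pi_pos
  have hCR := CR_pos
  have h2 := hf.rep_shift (ω := powWt s) hν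
  rw [hf.enormF_eq] at h2
  have h1 := fun m => (h2.mul hν Mode.mul_zero_left
    (rep_taylorTerm hν hθ (powWt s) (m + 2))).collapse
    (b := fun n => ENNReal.ofReal (bCoef n s)) (powWt_multiset_sum_le hs)
  have e1 : ∑' m : ℕ, ENNReal.ofReal (normF ν f) *
      ENNReal.ofReal (normF ν θ ^ (m + 2) / (Nat.factorial (m + 2) : ℝ))
      = ENNReal.ofReal (normF ν f * (Real.exp (normF ν θ) - 1 - normF ν θ)) := by
    rw [ENNReal.tsum_mul_left, tsum_ofReal_eq (fun m => by positivity)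
      (hasSum_exp_tail_two (normF ν θ)), ENNReal.ofReal_mul hf0]
  have h3 := Rep.tsum hν (fun u hu β hβ => hu.norm_le_one β hβ) h1
    (by rw [e1]; exact ENNReal.ofReal_ne_top)
  rw [e1] at h3
  have h4 := h3.principalValue hν ENNReal.ofReal_ne_top (k := kernelTail f θ) fun α β hβ => by
    rw [kernelTail_eq α hβ, taylorSum₂, tsum_mul_left, tsum_mul_left]
  refine ⟨h4.1, (h4.2.smul (1 / (π : ℂ))).mono (le_of_eq ?_) (le_of_eq ?_)⟩
  all_goals
    rw [aCoef_one, show ‖1 / (π : ℂ)‖ₑ = ENNReal.ofReal (1 / π) by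
      rw [← ofReal_norm, norm_div, norm_one, Complex.norm_real, Real.norm_of_nonneg hpi.le]]
  · rw [← ENNReal.ofReal_mul (by positivity), ← ENNReal.ofReal_mul (by positivity)]
    congr 1
    field_simp
  · have e3 : ∀ m, ENNReal.ofReal (bCoef (1 + (m + 2)) s) * (enormFW ν (powWt s) f *
          ENNReal.ofReal (normF ν θ ^ (m + 2) / (Nat.factorial (m + 2) : ℝ)) +
        ENNReal.ofReal (normF ν f) * (ENNReal.ofReal (((m + 2 : ℕ) : ℝ) * normF ν θ ^ (m + 2 - 1) /
          (Nat.factorial (m + 2) : ℝ)) * enormFW ν (powWt s) θ))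
        = ENNReal.ofReal (C3breveTerm s (normF ν θ) m) *
            (ENNReal.ofReal (normF ν θ ^ 2) * enormFW ν (powWt s) f) +
          ENNReal.ofReal (C4breveTerm s (normF ν θ) m) *
            (ENNReal.ofReal (normF ν θ * normF ν f) * enormFW ν (powWt s) θ) := by
      intro m
      have hb := bCoef_nonneg (m + 3) s
      have hfac : (0 : ℝ) < Nat.factorial (m + 1) := by exact_mod_cast Nat.factorial_pos (m + 1)
      have c3 : C3breveTerm s (normF ν θ) m * normF ν θ ^ 2
          = bCoef (m + 3) s * (normF ν θ ^ (m + 2) / (Nat.factorial (m + 2) : ℝ)) := by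
        rw [C3breveTerm]; ring
      have c4 : C4breveTerm s (normF ν θ) m * (normF ν θ * normF ν f)
          = bCoef (m + 3) s * (normF ν f * (((m + 2 : ℕ) : ℝ) * normF ν θ ^ (m + 2 - 1) /
            (Nat.factorial (m + 2) : ℝ))) := by
        rw [C4breveTerm, Nat.factorial_succ (m + 1), show m + 2 - 1 = m + 1 by omega]
        push_cast
        field_simp
        ring
      rw [← mul_assoc (ENNReal.ofReal (C3breveTerm s (normF ν θ) m)),
        ← mul_assoc (ENNReal.ofReal (C4breveTerm s (normF ν θ) m)),
        ← ENNReal.ofReal_mul (C3breveTerm_nonneg hx m),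
        ← ENNReal.ofReal_mul (C4breveTerm_nonneg hx m), c3, c4, show 1 + (m + 2) = m + 3 by ring,
        ENNReal.ofReal_mul hb, ENNReal.ofReal_mul hb, ENNReal.ofReal_mul hf0]
      ring
    have h3n : 0 ≤ ∑' m, C3breveTerm s (normF ν θ) m := tsum_nonneg (C3breveTerm_nonneg hx)
    have h4n : 0 ≤ ∑' m, C4breveTerm s (normF ν θ) m := tsum_nonneg (C4breveTerm_nonneg hx)
    rw [tsum_congr e3, ENNReal.tsum_add, ENNReal.tsum_mul_right, ENNReal.tsum_mul_right,
      ← ENNReal.ofReal_tsum_of_nonneg (C3breveTerm_nonneg hx) (summable_C3breveTerm hx),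
      ← ENNReal.ofReal_tsum_of_nonneg (C4breveTerm_nonneg hx) (summable_C4breveTerm hx),
      ← mul_assoc, ← ENNReal.ofReal_mul (by positivity), show 1 / π * (π * CR) = CR by field_simp,
      mul_add, mul_assoc CR, mul_assoc CR, mul_assoc CR, ENNReal.ofReal_mul hCR.le,
      ENNReal.ofReal_mul hCR.le, ENNReal.ofReal_mul h3n, mul_assoc (∑' m, C4breveTerm s _ m),
      ENNReal.ofReal_mul h4n]
    ring

/-! ### Convergence of the series and assembly of the operator -/

lemma summable_taylorTerm (hν : 0 ≤ ν) (hθ : MemF ν θ) (α β : ℝ) :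
    Summable (taylorTerm θ α β) := by
  have hb : ∀ t, ‖θ t‖ ≤ normF ν θ := by
    intro t
    have h := (hθ.rep (ω := 0) hν).norm_le hν zero_le_one isOne_norm_le
      (by rw [hθ.enormF_eq]; exact ENNReal.ofReal_ne_top) t pi_mem_punct
    rwa [hθ.enormF_eq, ENNReal.toReal_ofReal (normF_nonneg ν θ), mul_one] at h
  refine Summable.of_norm_bounded (Real.summable_pow_div_factorial (normF ν θ)) fun m => ?_
  have h1 : ‖∫ τ in (0 : ℝ)..1, Complex.exp (Complex.I * (((τ - 1) * β : ℝ) : ℂ)) *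
      θ (α + (τ - 1) * β) ^ m‖ ≤ normF ν θ ^ m * |1 - 0| := by
    refine intervalIntegral.norm_integral_le_of_norm_le_const fun τ _ => ?_
    rw [norm_mul, mul_comm Complex.I, Complex.norm_exp_ofReal_mul_I, one_mul, norm_pow]
    exact pow_le_pow_left₀ (norm_nonneg _) (hb _) m
  rw [sub_zero, abs_one, mul_one] at h1
  rw [taylorTerm, norm_mul, norm_div, norm_pow, Complex.norm_I, one_pow, Complex.norm_natCast,
    one_div, inv_mul_eq_div]
  gcongr

lemma tsum_ofReal_C1Term (hx : π / 2 * (Real.exp (normF ν θ) - 1) < 1) :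
    ∑' p : Idx, ENNReal.ofReal (C1Term (normF ν θ) p.1 * normF ν f)
      = ENNReal.ofReal ((C1 (normF ν θ) * normF ν θ ^ 2 -
          CR * (Real.exp (normF ν θ) - 1 - normF ν θ)) * normF ν f) :=
  tsum_ofReal_eq (fun _ => mul_nonneg (C1Term_nonneg (normF_nonneg ν θ) _) (normF_nonneg ν f))
    ((hasSum_C1Term (normF_nonneg ν θ) hx).mul_right _)

lemma summable_sTerm (hν : 0 ≤ ν) (hf : MemF ν f) (hθ : MemF ν θ)
    (hsm : π / 2 * (Real.exp (normF ν θ) - 1) < 1) (α : ℝ) : Summable (sTerm θ f α) := by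
  have hs : Summable fun p : Idx => 1 / (π : ℂ) * sTerm θ f α p := by
    refine Summable.of_norm_bounded
      ((hasSum_C1Term (normF_nonneg ν θ) hsm).mul_right (normF ν f)).summable fun p => ?_
    have h := (rep_sTerm hν hf hθ one_pos p).norm_le hν zero_le_one isOne_norm_le
      ENNReal.ofReal_ne_top α pi_mem_punct
    rwa [ENNReal.toReal_ofReal (mul_nonneg (C1Term_nonneg (normF_nonneg ν θ) _)
      (normF_nonneg ν f)), mul_one] at h
  have hp : (1 / (π : ℂ)) ≠ 0 := one_div_ne_zero (by exact_mod_cast Real.pi_ne_zero)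
  exact (summable_mul_left_iff hp).1 hs

lemma sConverges (hν : 0 ≤ ν) (hf : MemF ν f) (hθ : MemF ν θ)
    (hsm : π / 2 * (Real.exp (normF ν θ) - 1) < 1) : SConverges θ f :=
  ⟨summable_taylorTerm hν hθ, fun α n => (rep_kernelN hν hf hθ one_pos n).1 α,
    (rep_kernelTail hν hf hθ one_pos).1, summable_sTerm hν hf hθ hsm⟩

lemma rep_S (hν : 0 ≤ ν) (hf : MemF ν f) (hθ : MemF ν θ)
    (hsm : π / 2 * (Real.exp (normF ν θ) - 1) < 1) (hs : 0 < s) :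
    Rep ν (powWt s) IsOne 1
      (ENNReal.ofReal (C1 (normF ν θ) * normF ν θ ^ 2 * normF ν f))
      (ENNReal.ofReal (C3 s (normF ν θ) * normF ν θ ^ 2) * enormFW ν (powWt s) f +
        ENNReal.ofReal (C4 s (normF ν θ) * normF ν θ * normF ν f) * enormFW ν (powWt s) θ)
      fun α _ => S θ f α := by
  have hx := normF_nonneg ν θ
  have hf0 := normF_nonneg ν f
  have hCR := CR_pos
  have hexp : 0 ≤ Real.exp (normF ν θ) - 1 - normF ν θ := by
    linarith [Real.add_one_le_exp (normF ν θ)]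
  have e1 := tsum_ofReal_C1Term (ν := ν) (θ := θ) (f := f) hsm
  have h1 := Rep.tsum hν isOne_norm_le (fun p => rep_sTerm hν hf hθ hs p)
    (by rw [e1]; exact ENNReal.ofReal_ne_top)
  have hC3 : 0 ≤ ∑' p : Idx, C3tildeTerm s (normF ν θ) p := tsum_nonneg (C3tildeTerm_nonneg hx)
  have hC4 : 0 ≤ ∑' p : Idx, C4tildeTerm s (normF ν θ) p := tsum_nonneg (C4tildeTerm_nonneg hx)
  have h3n : 0 ≤ ∑' m, C3breveTerm s (normF ν θ) m := tsum_nonneg (C3breveTerm_nonneg hx)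
  have h4n : 0 ≤ ∑' m, C4breveTerm s (normF ν θ) m := tsum_nonneg (C4breveTerm_nonneg hx)
  have e2 : ∑' p : Idx, (ENNReal.ofReal (C3tildeTerm s (normF ν θ) p * normF ν θ ^ 2) *
        enormFW ν (powWt s) f + ENNReal.ofReal (C4tildeTerm s (normF ν θ) p * normF ν θ *
        normF ν f) * enormFW ν (powWt s) θ)
      = ENNReal.ofReal ((∑' p : Idx, C3tildeTerm s (normF ν θ) p) * normF ν θ ^ 2) *
        enormFW ν (powWt s) f + ENNReal.ofReal ((∑' p : Idx, C4tildeTerm s (normF ν θ) p) *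
        normF ν θ * normF ν f) * enormFW ν (powWt s) θ := by
    rw [ENNReal.tsum_add, ENNReal.tsum_mul_right, ENNReal.tsum_mul_right,
      tsum_ofReal_eq (fun p => mul_nonneg (C3tildeTerm_nonneg hx p) (sq_nonneg _))
        ((summable_C3tildeTerm hx hsm).hasSum.mul_right _),
      tsum_ofReal_eq (fun p => mul_nonneg (mul_nonneg (C4tildeTerm_nonneg hx p) hx) hf0)
        (((summable_C4tildeTerm hx hsm).hasSum.mul_right _).mul_right _)]
  rw [e1, e2] at h1
  have h2 := (rep_kernelTail hν hf hθ hs).2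
  have h3 := h1.add hν isOne_norm_le h2 ENNReal.ofReal_ne_top ENNReal.ofReal_ne_top
  -- The difference is the sum of a series with nonnegative terms; this allows the two bounds to be
  -- added inside `ENNReal.ofReal`.
  have hpos : 0 ≤ C1 (normF ν θ) * normF ν θ ^ 2 -
      CR * (Real.exp (normF ν θ) - 1 - normF ν θ) :=
    (hasSum_C1Term hx hsm).nonneg fun p => C1Term_nonneg hx _
  refine (h3.congr fun α β _ => ?_).mono (le_of_eq ?_) (le_of_eq ?_)
  · rw [S, ← tsum_mul_left]
  · rw [← ENNReal.ofReal_add (mul_nonneg hpos hf0) (by positivity)]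
    congr 1; ring
  · rw [C3, C4]
    generalize enormFW ν (powWt s) f = Tf
    generalize enormFW ν (powWt s) θ = Tθ
    rw [add_mul (∑' p : Idx, C3tildeTerm s _ p), add_mul (∑' p : Idx, C4tildeTerm s _ p), add_mul,
      ENNReal.ofReal_add (p := (∑' p : Idx, C3tildeTerm s _ p) * _) (by positivity) (by positivity),
      ENNReal.ofReal_add (p := (∑' p : Idx, C4tildeTerm s _ p) * _ * _) (by positivity)
        (by positivity)]
    ring

end

end

end BirkhoffRott

theorem proposition5p4 (ν : ℝ) (hν : 0 ≤ ν) (f θ : ℝ → ℂ)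
    (hf : BirkhoffRott.MemF ν f) (hθ : BirkhoffRott.MemF ν θ)
    (hsmall : Real.pi / 2 * (Real.exp (BirkhoffRott.normF ν θ) - 1) < 1) :
    BirkhoffRott.SConverges θ f ∧
    BirkhoffRott.MemF ν (BirkhoffRott.S θ f) ∧
    0 < BirkhoffRott.C1 (BirkhoffRott.normF ν θ) ∧
    BirkhoffRott.normF ν (BirkhoffRott.S θ f) ≤
      BirkhoffRott.C1 (BirkhoffRott.normF ν θ) *
        BirkhoffRott.normF ν θ ^ 2 * BirkhoffRott.normF ν f ∧
    ∀ s : ℝ, 0 < s →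
      BirkhoffRott.ConstSeriesConverge s (BirkhoffRott.normF ν θ) ∧
      0 < BirkhoffRott.C3 s (BirkhoffRott.normF ν θ) ∧
      0 < BirkhoffRott.C4 s (BirkhoffRott.normF ν θ) ∧
      (BirkhoffRott.FiniteHomNormF ν s f → BirkhoffRott.FiniteHomNormF ν s θ →
        BirkhoffRott.FiniteHomNormF ν s (BirkhoffRott.S θ f) ∧
        BirkhoffRott.homNormF ν s (BirkhoffRott.S θ f) ≤
          BirkhoffRott.C3 s (BirkhoffRott.normF ν θ) *
              BirkhoffRott.normF ν θ ^ 2 * BirkhoffRott.homNormF ν s f +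
            BirkhoffRott.C4 s (BirkhoffRott.normF ν θ) *
              BirkhoffRott.normF ν θ * BirkhoffRott.normF ν f *
              BirkhoffRott.homNormF ν s θ) := by
  open BirkhoffRott in
  have hx := normF_nonneg ν θ
  have hf0 := normF_nonneg ν f
  have hC1 := C1_pos hx hsmall
  -- The first bound does not depend on `s`, so `s = 1` serves, and the second bound, possibly
  -- infinite, is discarded.
  obtain ⟨hc, hp, hX, -⟩ := (rep_S hν hf hθ hsmall one_pos).memF hν ENNReal.ofReal_ne_top
  unfold enormF at hX
  simp_rw [ewt_mul_enorm] at hX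
  have hN := summable_of_tsum_ofReal_le (normTerm_nonneg _) (by positivity) hX
  refine ⟨sConverges hν hf hθ hsmall, ⟨hc, hp, hN.1⟩, hC1, hN.2, fun s hs => ?_⟩
  have hC3 := C3_pos (s := s) hx hsmall
  have hC4 := C4_pos (s := s) hx hsmall
  refine ⟨constSeriesConverge hx hsmall, hC3, hC4, fun hsf hsθ => ?_⟩
  obtain ⟨-, -, -, hY⟩ := (rep_S hν hf hθ hsmall hs).memF hν ENNReal.ofReal_ne_top
  have h1 := homNormF_nonneg ν s f
  have h2 := homNormF_nonneg ν s θ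
  rw [enormFW_eq hs hsf, enormFW_eq hs hsθ, enormFW_powWt hs, ← ENNReal.ofReal_mul (by positivity),
    ← ENNReal.ofReal_mul (by positivity), ← ENNReal.ofReal_add (by positivity) (by positivity)]
    at hY
  exact summable_of_tsum_ofReal_le (homNormTerm_nonneg _) (by positivity) hY
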